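/- Let $d\ge 0$ be an integer, write $T^*\mathbb R^d\cong\mathbb R^{2d}$, $z=(x,\xi)$, $\langle z\rangle=(1+|z|^2)^{1/2}$. Pairings $(\cdot,\cdot)$ of $\mathscr S'$ and $\mathscr S$ are conjugate linear in the second argument. Definitions. Let $\psi_0(y)=\pi^{-d/4}e^{-|y|^2/2}$ and, for $f\in\mathscr S(\mathbb R^d)$, $V_{\psi_0}f(x,\xi)=\int_{\mathbb R^d} f(y)\,\overline{e^{iy\cdot\xi}\psi_0(y-x)}\,dy$. For $a\in\mathscr S'(\mathbb R^{2d})$ the localization operator $A_a:\mathscr S(\mathbb R^d)\to\mathscr S'(\mathbb R^d)$ is defined by $(A_af,g)=(2\pi)^{-d}(a\,V_{\psi_0}f,V_{\psi_0}g)$, $f,g\in\mathscr S(\mathbb R^d)$. For $b\in\mathscr S'(\mathbb R^{2d})$ the Weyl operator $b^w(x,D):\mathscr S(\mathbb R^d)\to\mathscr S'(\mathbb R^d)$ is the weakly defined operator with formal expression $$b^w(x,D)f(x)=(2\pi)^{-d}\iint e^{i(x-y)\cdot\xi}\,b\big(\tfrac{x+y}2,\xi\big)f(y)\,dy\,d\xi,$$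 that is, $(b^w(x,D)f,g)=(2\pi)^{-d}\langle b,W(f,\overline g)\rangle$ with the bilinear pairing $\langle\cdot,\cdot\rangle$ and $W(f,\varphi)(x,\xi)=\int e^{it\cdot\xi}f(x-\tfrac t2)\varphi(x+\tfrac t2)\,dt$. For $m\in\mathbb R$, $G^m$ is the set of $a\in C^\infty(\mathbb R^{2d})$ such that for every $\alpha\in\mathbb N^{2d}$ there is $C_\alpha>0$ with $|\partial^\alpha a(z)|\le C_\alpha\langle z\rangle^{m-|\alpha|}$ for all $z$. An open cone is an open set $\Gamma\subseteq\mathbb R^{2d}\setminus 0$ with $t\Gamma\subseteq\Gamma$ for all $t>0$. For $a\in G^m$ and $m'\le m$, $\operatorname{char}_{m'}(a)$ is the set of $z_0\in\mathbb R^{2d}\setminus0$ for which there do not exist an open cone $\Gamma\ni z_0$ and constants $A,C,C_\alpha>0$ with $$|a(z)|\ge C\langle z\rangle^{m'},\qquad |\partial^\alpha a(z)|\le C_\alpha|a(z)|\langle z\rangle^{-|\alpha|}\qquad(\alpha\in\mathbb N^{2d},\ z\in\Gamma,\ |z|\ge A),$$ and $\mu\operatorname{supp}(a)$ is the set of $z_0\in\mathbb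 R^{2d}\setminus0$ for which there is no open cone $\Gamma\ni z_0$ with $\sup_{z\in\Gamma}\langle z\rangle^N|\partial^\alpha a(z)|<\infty$ for all $\alpha\in\mathbb N^{2d}$ and $N\ge0$. Proposition (Weyl–Wick connection). (i) If $a\in\mathscr S'(\mathbb R^{2d})$, then $A_a=b^w(x,D)$ with $b=\pi^{-d}e^{-|\cdot|^2}*a\in\mathscr S'(\mathbb R^{2d})$. (ii) There are constants $c_\alpha\in\mathbb C$, $\alpha\in\mathbb N^{2d}$, with $c_0=1$, depending only on $d$ and $\alpha$, such that for every $m\in\mathbb R$ and every $a\in G^m$ the tempered distribution $b=\pi^{-d}e^{-|\cdot|^2}*a$ is given by the function $b(z)=\pi^{-d}\int_{\mathbb R^{2d}} e^{-|w|^2}a(z-w)\,dw$, which satisfies: - $b\in G^m$; - $b\sim\sum_{\alpha\in\mathbb N^{2d}}c_\alpha\,\partial^\alpha a$, that is, $c_\alpha\partial^\alpha a\in G^{m-|\alpha|}$ for all $\alpha$ and $b-\sum_{|\alpha|<n}c_\alpha\,\partial^\alpha a\in G^{m-n}$ for every integer $n\ge1$; - $\operatorname{char}_{m'}(b)\subseteq\operatorname{char}_{m'}(a)$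 for every $m'\le m$; - $\mu\operatorname{supp}(b)\subseteq\mu\operatorname{supp}(a)$. -/

import Mathlib

namespace WeylWick

open MeasureTheory SchwartzMap FourierTransform Complex
open scoped ContDiff ComplexConjugate

/-- Configuration space `ℝ^d` with its Euclidean norm. -/
abbrev Config (d : ℕ) := EuclideanSpace ℝ (Fin d)

/-- Phase space `T*ℝ^d = ℝ^d × ℝ^d = ℝ^(2d)` with its Euclidean norm; points are `z = (x, ξ)` with
`x = z.fst` and `ξ = z.snd`. -/
abbrev Phase (d : ℕ) := WithLp 2 (Config d × Config d)

section

variable {d : ℕ}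

/-! ### Short-time Fourier transform and Wigner transform of Schwartz functions -/

theorem exists_gaussian_decay {V : Type*} [NormedAddCommGroup V] [InnerProductSpace ℝ V]
    {b : ℝ} (hb : 0 < b) (k n : ℕ) :
    ∃ C : ℝ, ∀ x : V, ‖x‖ ^ k *
      ‖iteratedFDeriv ℝ n (fun x : V => Real.exp (-b * ‖x‖ ^ 2)) x‖ ≤ C := by
  have hq : (fun x : V => -b * ‖x‖ ^ 2).HasTemperateGrowth := by fun_prop
  obtain ⟨l, C, hC, h⟩ := hq.norm_iteratedFDeriv_le_uniform n
  refine ⟨n.factorial * (1 + C) ^ n * ((k + l * n).factorial * Real.exp (1 + 1 / (4 * b))),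
    fun x => ?_⟩
  have h1 : ‖iteratedFDeriv ℝ n (Real.exp ∘ fun x : V => -b * ‖x‖ ^ 2) x‖ ≤
      n.factorial * Real.exp (-b * ‖x‖ ^ 2) * ((1 + C) * (1 + ‖x‖) ^ l) ^ n := by
    refine norm_iteratedFDeriv_comp_le (N := ∞) Real.contDiff_exp hq.1 (mod_cast le_top) x ?_ ?_
    · intro i _
      rw [norm_iteratedFDeriv_eq_norm_iteratedDeriv, iteratedDeriv_eq_iterate, Real.iter_deriv_exp,
        Real.norm_eq_abs, Real.abs_exp]
    · intro i hi hi'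
      calc _ ≤ C * (1 + ‖x‖) ^ l := h i hi' x
        _ ≤ (1 + C) * (1 + ‖x‖) ^ l := by gcongr; simp
        _ ≤ _ := by
          apply le_self_pow₀ (one_le_mul_of_one_le_of_one_le (by simp [hC])
            (one_le_pow₀ (by simp)))
          omega
  have h2 : (1 + ‖x‖) ^ (k + l * n) * Real.exp (-b * ‖x‖ ^ 2) ≤
      (k + l * n).factorial * Real.exp (1 + 1 / (4 * b)) := by
    have h3 : (1 + ‖x‖) ^ (k + l * n) ≤ (k + l * n).factorial * Real.exp (1 + ‖x‖) := by
      have := Real.pow_div_factorial_le_exp (1 + ‖x‖) (by positivity) (k + l * n)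
      rw [div_le_iff₀ (by positivity)] at this
      linarith
    calc _ ≤ (k + l * n).factorial * Real.exp (1 + ‖x‖) * Real.exp (-b * ‖x‖ ^ 2) := by gcongr
      _ = (k + l * n).factorial * Real.exp (1 + ‖x‖ + -b * ‖x‖ ^ 2) := by
        rw [Real.exp_add (1 + ‖x‖)]; ring
      _ ≤ _ := by
        refine mul_le_mul_of_nonneg_left (Real.exp_le_exp.2 ?_) (by positivity)
        have : 0 ≤ b * (‖x‖ - 1 / (2 * b)) ^ 2 := by positivity
        have e : b * (‖x‖ - 1 / (2 * b)) ^ 2 = b * ‖x‖ ^ 2 - ‖x‖ + 1 / (4 * b) := by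
          field_simp; ring
        linarith
  calc _ ≤ (1 + ‖x‖) ^ k * (n.factorial * Real.exp (-b * ‖x‖ ^ 2) *
        ((1 + C) * (1 + ‖x‖) ^ l) ^ n) := by
        refine mul_le_mul ?_ h1 (norm_nonneg _) (by positivity)
        gcongr; simp
    _ = n.factorial * (1 + C) ^ n * ((1 + ‖x‖) ^ (k + l * n) * Real.exp (-b * ‖x‖ ^ 2)) := by
        rw [mul_pow, ← pow_mul, pow_add]; ring
    _ ≤ _ := by gcongr

/-- The Gaussian `x ↦ exp (-b * ‖x‖ ^ 2)` as a Schwartz function. -/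
noncomputable def gaussianSchwartz (V : Type*) [NormedAddCommGroup V] [InnerProductSpace ℝ V]
    {b : ℝ} (hb : 0 < b) : 𝓢(V, ℂ) :=
  postcompCLM (𝕜 := ℝ) Complex.ofRealCLM
    { toFun := fun x : V => Real.exp (-b * ‖x‖ ^ 2)
      smooth' := by
        have hq : (fun x : V => -b * ‖x‖ ^ 2).HasTemperateGrowth := by fun_prop
        exact Real.contDiff_exp.comp hq.1
      decay' := exists_gaussian_decay hb }

theorem hasTemperateGrowth_expI : (fun r : ℝ => Complex.exp (r * I)).HasTemperateGrowth := by
  refine ⟨(Complex.ofRealCLM.contDiff.mul contDiff_const).cexp, fun n => ⟨0, 1, fun x => ?_⟩⟩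
  rw [norm_iteratedFDeriv_eq_norm_iteratedDeriv]
  have : ∀ n : ℕ, iteratedDeriv n (fun r : ℝ => Complex.exp (r * I)) =
      fun r : ℝ => I ^ n * Complex.exp (r * I) := by
    intro n
    induction n with
    | zero => simp
    | succ n ih =>
      rw [iteratedDeriv_succ, ih]
      funext r
      have h : HasDerivAt (fun r : ℝ => Complex.exp (r * I)) (Complex.exp (r * I) * (1 * I)) r :=
        ((Complex.ofRealCLM.hasDerivAt (x := r)).mul_const I).cexp
      rw [(h.const_mul (I ^ n)).deriv]
      ring
  rw [this]
  simp [Complex.norm_exp_ofReal_mul_I]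


theorem hasTemperateGrowth_chirp (c : ℝ) : (fun z : Phase d =>
    Complex.exp ((c * inner ℝ z.fst z.snd : ℝ) * I)).HasTemperateGrowth := by
  have hf : (fun z : Phase d => z.fst).HasTemperateGrowth :=
    (WithLp.fstL 2 ℝ (Config d) (Config d)).hasTemperateGrowth
  have hs : (fun z : Phase d => z.snd).HasTemperateGrowth :=
    (WithLp.sndL 2 ℝ (Config d) (Config d)).hasTemperateGrowth
  have hi : (fun z : Phase d => inner ℝ z.fst z.snd).HasTemperateGrowth :=
    (innerSL ℝ (E := Config d)).bilinear_hasTemperateGrowth hf hs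
  have hc : (fun z : Phase d => c * inner ℝ z.fst z.snd).HasTemperateGrowth := by fun_prop
  exact hasTemperateGrowth_expI.comp hc

theorem tensor_bound (k : 𝓢(Config d, ℂ)) (n : ℕ × ℕ) :
    ∃ (s : Finset (ℕ × ℕ)) (C : ℝ), 0 ≤ C ∧ ∀ (f : 𝓢(Config d, ℂ)) (z : Phase d),
      ‖z‖ ^ n.1 * ‖iteratedFDeriv ℝ n.2 (fun z : Phase d => k z.fst * f z.snd) z‖ ≤
        C * s.sup (schwartzSeminormFamily ℂ (Config d) ℂ) f := by
  obtain ⟨p, n⟩ := n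
  set Λ : Seminorm ℂ 𝓢(Config d, ℂ) :=
    (Finset.Iic (p, n)).sup (schwartzSeminormFamily ℂ (Config d) ℂ)
  refine ⟨Finset.Iic (p, n),
    (2 : ℝ) ^ n * (2 ^ p * Λ k * 2 ^ p), by positivity, fun f z => ?_⟩
  have hL : ∀ (L : Phase d →L[ℝ] Config d), ‖L‖ ≤ 1 → ∀ (g : 𝓢(Config d, ℂ)) (i : ℕ), i ≤ n →
      (1 + ‖L z‖) ^ p * ‖iteratedFDeriv ℝ i (fun z : Phase d => g (L z)) z‖ ≤ 2 ^ p * Λ g := by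
    intro L hL g i hi
    have h1 : ‖iteratedFDeriv ℝ i (fun z : Phase d => g (L z)) z‖ ≤
        ‖iteratedFDeriv ℝ i g (L z)‖ := by
      have := L.iteratedFDeriv_comp_right (g.smooth i) z (i := i) le_rfl
      change ‖iteratedFDeriv ℝ i (g ∘ L) z‖ ≤ _
      rw [this]
      refine (ContinuousMultilinearMap.norm_compContinuousLinearMap_le _ _).trans ?_
      calc _ ≤ ‖iteratedFDeriv ℝ i g (L z)‖ * ∏ _j : Fin i, (1 : ℝ) := by
            gcongr
        _ = _ := by simp
    refine le_trans (by gcongr) (one_add_le_sup_seminorm_apply (𝕜 := ℂ) (m := (p, n)) le_rfl hi g (L z))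
  have hz : ‖z‖ ≤ (1 + ‖z.fst‖) * (1 + ‖z.snd‖) := by
    have : ‖z‖ ≤ ‖z.fst‖ + ‖z.snd‖ := by
      rw [WithLp.prod_norm_eq_of_L2]
      refine Real.sqrt_le_iff.2 ⟨by positivity, ?_⟩
      nlinarith [norm_nonneg z.fst, norm_nonneg z.snd]
    nlinarith [norm_nonneg z.fst, norm_nonneg z.snd]
  have hfst : ‖WithLp.fstL 2 ℝ (Config d) (Config d)‖ ≤ 1 :=
    ContinuousLinearMap.opNorm_le_bound _ zero_le_one fun z => by
      simpa using WithLp.norm_fst_le (p := 2) _ z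
  have hsnd : ‖WithLp.sndL 2 ℝ (Config d) (Config d)‖ ≤ 1 :=
    ContinuousLinearMap.opNorm_le_bound _ zero_le_one fun z => by
      simpa using WithLp.norm_snd_le (p := 2) _ z
  have hkc : ContDiff ℝ ∞ (fun z : Phase d => k (WithLp.fstL 2 ℝ (Config d) (Config d) z)) :=
    (k.smooth ⊤).comp (ContinuousLinearMap.contDiff _)
  have hfc : ContDiff ℝ ∞ (fun z : Phase d => f (WithLp.sndL 2 ℝ (Config d) (Config d) z)) :=
    (f.smooth ⊤).comp (ContinuousLinearMap.contDiff _)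
  have hm := norm_iteratedFDeriv_mul_le hkc hfc z (n := n) (mod_cast le_top)
  calc ‖z‖ ^ p * ‖iteratedFDeriv ℝ n (fun z : Phase d => k z.fst * f z.snd) z‖
      ≤ ((1 + ‖z.fst‖) * (1 + ‖z.snd‖)) ^ p * _ :=
        mul_le_mul (pow_le_pow_left₀ (norm_nonneg _) hz p) hm (norm_nonneg _) (by positivity)
    _ = ∑ i ∈ Finset.range (n + 1), (n.choose i : ℝ) *
        (((1 + ‖z.fst‖) ^ p * ‖iteratedFDeriv ℝ i
          (fun z : Phase d => k (WithLp.fstL 2 ℝ (Config d) (Config d) z)) z‖) *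
        ((1 + ‖z.snd‖) ^ p * ‖iteratedFDeriv ℝ (n - i)
          (fun z : Phase d => f (WithLp.sndL 2 ℝ (Config d) (Config d) z)) z‖)) := by
        rw [Finset.mul_sum]
        refine Finset.sum_congr rfl fun i _ => ?_
        rw [mul_pow]; ring
    _ ≤ ∑ i ∈ Finset.range (n + 1), (n.choose i : ℝ) * ((2 ^ p * Λ k) * (2 ^ p * Λ f)) := by
        refine Finset.sum_le_sum fun i hi => ?_
        have hi' : i ≤ n := by simpa [Nat.lt_succ_iff] using hi
        refine mul_le_mul_of_nonneg_left ?_ (Nat.cast_nonneg _)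
        exact mul_le_mul (hL _ hfst k i hi') (hL _ hsnd f (n - i) (Nat.sub_le _ _))
          (by positivity) (by positivity)
    _ = _ := by
        rw [← Finset.sum_mul]
        have : ∑ i ∈ Finset.range (n + 1), (n.choose i : ℝ) = 2 ^ n := by
          exact_mod_cast Nat.sum_range_choose n
        rw [this]; ring

/-- The tensor product `(x, ξ) ↦ k x * f ξ`, continuous in `f`. -/
noncomputable def tensorCLM (k : 𝓢(Config d, ℂ)) : 𝓢(Config d, ℂ) →L[ℂ] 𝓢(Phase d, ℂ) :=
  mkCLM (fun f z => k z.fst * f z.snd) (fun f g x => by simp [mul_add])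
    (fun a f x => by simp; ring)
    (fun f => ((k.smooth ⊤).comp (WithLp.fstL 2 ℝ (Config d) (Config d)).contDiff).mul
      ((f.smooth ⊤).comp (WithLp.sndL 2 ℝ (Config d) (Config d)).contDiff))
    (tensor_bound k)

/-- Reflection `f ↦ f (-·)`. -/
noncomputable def reflectCLM (d : ℕ) : 𝓢(Config d, ℂ) →L[ℂ] 𝓢(Config d, ℂ) :=
  compCLMOfContinuousLinearEquiv ℂ (ContinuousLinearEquiv.neg ℝ)

/-- Complex conjugation of Schwartz functions. -/
noncomputable def conjCLM (V : Type*) [NormedAddCommGroup V] [NormedSpace ℝ V] :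
    𝓢(V, ℂ) →L[ℝ] 𝓢(V, ℂ) :=
  postcompCLM (𝕜 := ℝ) (Complex.conjCLE : ℂ →L[ℝ] ℂ)

theorem conjCLM_apply {V : Type*} [NormedAddCommGroup V] [NormedSpace ℝ V] (f : 𝓢(V, ℂ)) (x : V) :
    conjCLM V f x = conj (f x) := rfl

/-- The continuous linear map `f ↦ ((x, ξ) ↦ ∫ exp (-2πi y·ξ) f y h (y - x) dy)` into the Schwartz
space of phase space, see `shortTimeCLM_apply`. -/
noncomputable def shortTimeCLM (h : 𝓢(Config d, ℂ)) : 𝓢(Config d, ℂ) →L[ℂ] 𝓢(Phase d, ℂ) :=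
  fourierInvCLM ℂ 𝓢(Phase d, ℂ) ∘L
    smulLeftCLM ℂ (fun z : Phase d => Complex.exp ((2 * Real.pi * inner ℝ z.fst z.snd : ℝ) * I)) ∘L
      tensorCLM (𝓕 (reflectCLM d h)) ∘L reflectCLM d

theorem tensorCLM_apply (k f : 𝓢(Config d, ℂ)) (z : Phase d) :
    tensorCLM k f z = k z.fst * f z.snd := rfl

theorem integral_phase (F : Phase d → ℂ) :
    ∫ z, F z = ∫ p : Config d × Config d, F (WithLp.toLp 2 p) :=
  ((WithLp.volume_preserving_toLp (Config d) (Config d)).integral_comp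
    (MeasurableEquiv.toLp 2 (Config d × Config d)).measurableEmbedding F).symm

theorem shortTimeCLM_apply (h f : 𝓢(Config d, ℂ)) (z : Phase d) :
    shortTimeCLM h f z = ∫ y, Complex.exp ((-(2 * Real.pi * inner ℝ y z.snd) : ℝ) * I) *
      (f y * h (y - z.fst)) := by
  have hG := hasTemperateGrowth_chirp (d := d) (2 * Real.pi)
  set k := 𝓕 (reflectCLM d h) with hk
  set G := smulLeftCLM ℂ (fun z : Phase d =>
    Complex.exp ((2 * Real.pi * inner ℝ z.fst z.snd : ℝ) * I)) (tensorCLM k (reflectCLM d f))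
  have hGa : ∀ w : Phase d, G w = Complex.exp ((2 * Real.pi * inner ℝ w.fst w.snd : ℝ) * I) *
      (k w.fst * f (-w.snd)) := fun w => by
    rw [smulLeftCLM_apply_apply hG]; rfl
  have hki : ∀ x, ∫ p, Complex.exp ((2 * Real.pi * inner ℝ p x : ℝ) * I) * k p = h (-x) := by
    intro x
    have : 𝓕⁻ k x = reflectCLM d h x := by rw [hk]; simp
    rw [fourierInv_coe, Real.fourierInv_eq'] at this
    exact this
  have h1 : shortTimeCLM h f z = ∫ w : Phase d,
      Complex.exp ((2 * Real.pi * inner ℝ w z : ℝ) * I) * G w := by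
    change 𝓕⁻ G z = _
    rw [fourierInv_coe, Real.fourierInv_eq']
    rfl
  have hint : Integrable (fun w : Phase d =>
      Complex.exp ((2 * Real.pi * inner ℝ w z : ℝ) * I) * G w) := by
    refine G.integrable.bdd_mul (c := 1) (by fun_prop) (ae_of_all _ fun w => ?_)
    rw [Complex.norm_exp_ofReal_mul_I]
  have hint2 : Integrable (fun p : Config d × Config d => Complex.exp
      ((2 * Real.pi * inner ℝ (WithLp.toLp 2 p : Phase d) z : ℝ) * I) * G (WithLp.toLp 2 p)) :=
    (WithLp.volume_preserving_toLp (Config d) (Config d)).integrable_comp_of_integrable hint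
  rw [Measure.volume_eq_prod] at hint2
  rw [h1, integral_phase, Measure.volume_eq_prod, integral_prod_symm _ hint2,
    ← integral_neg_eq_self]
  refine integral_congr_ae (ae_of_all _ fun y => ?_)
  dsimp only
  have : ∀ p : Config d, Complex.exp ((2 * Real.pi * inner ℝ (WithLp.toLp 2 (p, -y) : Phase d) z : ℝ) * I) *
      G (WithLp.toLp 2 (p, -y)) =
      (Complex.exp ((-(2 * Real.pi * inner ℝ y z.snd) : ℝ) * I) * f y) *
        (Complex.exp ((2 * Real.pi * inner ℝ p (z.fst - y) : ℝ) * I) * k p) := by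
    intro p
    rw [hGa, WithLp.prod_inner_apply]
    change Complex.exp ((2 * Real.pi * (inner ℝ p z.fst + inner ℝ (-y) z.snd) : ℝ) * I) *
      (Complex.exp ((2 * Real.pi * inner ℝ p (-y) : ℝ) * I) * (k p * f (-(-y)))) = _
    rw [inner_neg_left, inner_neg_right, neg_neg, inner_sub_right]
    have e : ∀ a b c : ℝ, Complex.exp (((2 * Real.pi * (a + -b)) : ℝ) * I) *
        (Complex.exp (((2 * Real.pi * -c) : ℝ) * I)) =
        Complex.exp (((-(2 * Real.pi * b)) : ℝ) * I) *
        Complex.exp (((2 * Real.pi * (a - c)) : ℝ) * I) := by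
      intro a b c
      rw [← Complex.exp_add, ← Complex.exp_add]
      congr 1; push_cast; ring
    have := e (inner ℝ p z.fst) (inner ℝ y z.snd) (inner ℝ p y)
    linear_combination (k p * f y) * this
  simp_rw [this]
  rw [integral_const_mul, hki, neg_sub]
  ring

/-- The dilation `(x, ξ) ↦ (a x, b ξ)` of phase space. -/
noncomputable def phaseScale (d : ℕ) (a b : ℝ) (ha : a ≠ 0) (hb : b ≠ 0) : Phase d ≃L[ℝ] Phase d :=
  ((WithLp.prodContinuousLinearEquiv 2 ℝ (Config d) (Config d)).trans
    ((ContinuousLinearEquiv.smulLeft (Units.mk0 a ha)).prodCongr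
      (ContinuousLinearEquiv.smulLeft (Units.mk0 b hb)))).trans
    (WithLp.prodContinuousLinearEquiv 2 ℝ (Config d) (Config d)).symm

theorem phaseScale_fst (a b : ℝ) (ha : a ≠ 0) (hb : b ≠ 0) (z : Phase d) :
    (phaseScale d a b ha hb z).fst = a • z.fst := rfl

theorem phaseScale_snd (a b : ℝ) (ha : a ≠ 0) (hb : b ≠ 0) (z : Phase d) :
    (phaseScale d a b ha hb z).snd = b • z.snd := rfl

/-- The time-frequency shift `Π(x, ξ) ψ (y) = exp (i y·ξ) ψ (y - x)`. -/
noncomputable def timeFreqShift (z : Phase d) (ψ : Config d → ℂ) : Config d → ℂ :=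
  fun y => Complex.exp ((inner ℝ y z.snd : ℝ) * I) * ψ (y - z.fst)

/-- The short-time Fourier transform `V_ψ f (z) = (f, Π(z) ψ)`. -/
noncomputable def stft (ψ f : Config d → ℂ) (z : Phase d) : ℂ :=
  ∫ y, f y * conj (timeFreqShift z ψ y)

/-- The short-time Fourier transform as a continuous linear map between Schwartz spaces;
`stftCLM_apply` identifies it with the integral `stft`. -/
noncomputable def stftCLM (ψ : 𝓢(Config d, ℂ)) : 𝓢(Config d, ℂ) →L[ℂ] 𝓢(Phase d, ℂ) :=
  compCLMOfContinuousLinearEquiv ℂ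
    (phaseScale d 1 (2 * Real.pi)⁻¹ one_ne_zero (inv_ne_zero Real.two_pi_pos.ne')) ∘L
    shortTimeCLM (conjCLM _ ψ)

theorem stftCLM_apply (ψ f : 𝓢(Config d, ℂ)) (z : Phase d) :
    stftCLM ψ f z = stft ψ f z := by
  change shortTimeCLM (conjCLM _ ψ) f (phaseScale d _ _ _ _ z) = _
  rw [shortTimeCLM_apply, stft]
  refine integral_congr_ae (ae_of_all _ fun y => ?_)
  simp only [phaseScale_fst, phaseScale_snd, timeFreqShift, map_mul, conjCLM_apply, one_smul, inner_smul_right,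
    ← Complex.exp_conj, Complex.conj_ofReal, Complex.conj_I]
  have : (2 * Real.pi * ((2 * Real.pi)⁻¹ * inner ℝ y z.snd) : ℝ) = inner ℝ y z.snd := by
    field_simp
  rw [this]
  push_cast
  rw [neg_mul_comm]
  ring

/-- The cross-Wigner transform `W(f, φ)(x, ξ) = ∫ exp (i t·ξ) f (x - t/2) φ (x + t/2) dt`
(bilinear version, without complex conjugation). -/
noncomputable def crossWigner (f φ : Config d → ℂ) (z : Phase d) : ℂ :=
  ∫ t, Complex.exp ((inner ℝ t z.snd : ℝ) * I) *
    (f (z.fst - (1 / 2 : ℝ) • t) * φ (z.fst + (1 / 2 : ℝ) • t))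

/-- The cross-Wigner transform `φ ↦ W(f, φ)` as a continuous linear map between Schwartz spaces;
`wignerCLM_apply` identifies it with the integral `crossWigner`. -/
noncomputable def wignerCLM (f : 𝓢(Config d, ℂ)) : 𝓢(Config d, ℂ) →L[ℂ] 𝓢(Phase d, ℂ) :=
  (2 : ℂ) ^ d •
    (smulLeftCLM ℂ (fun z : Phase d => Complex.exp (((-2) * inner ℝ z.fst z.snd : ℝ) * I)) ∘L
      compCLMOfContinuousLinearEquiv ℂ
        (phaseScale d 2 (-Real.pi⁻¹) two_ne_zero (neg_ne_zero.2 (inv_ne_zero Real.pi_ne_zero))) ∘L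
      shortTimeCLM (reflectCLM d f))

theorem wignerCLM_apply (f φ : 𝓢(Config d, ℂ)) (z : Phase d) :
    wignerCLM f φ z = crossWigner f φ z := by
  have hG := hasTemperateGrowth_chirp (d := d) (-2)
  have h1 : wignerCLM f φ z = (2 : ℂ) ^ d *
      (Complex.exp (((-2) * inner ℝ z.fst z.snd : ℝ) * I) *
        shortTimeCLM (reflectCLM d f) φ (phaseScale d 2 (-Real.pi⁻¹) two_ne_zero
          (neg_ne_zero.2 (inv_ne_zero Real.pi_ne_zero)) z)) := by
    change (2 : ℂ) ^ d * (smulLeftCLM ℂ _ _) z = _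
    rw [smulLeftCLM_apply_apply hG]; rfl
  have h2 := Measure.integral_comp_smul (volume : Measure (Config d))
    (fun y => Complex.exp ((2 * inner ℝ (z.fst + y) z.snd : ℝ) * I) *
      (φ (z.fst + y) * f (z.fst - y))) (1 / 2 : ℝ)
  have h3 : |(((1 / 2 : ℝ) ^ Module.finrank ℝ (Config d))⁻¹)| = 2 ^ d := by
    rw [finrank_euclideanSpace_fin, one_div, inv_pow, inv_inv, abs_of_pos (by positivity)]
  have h4 : shortTimeCLM (reflectCLM d f) φ (phaseScale d 2 (-Real.pi⁻¹) two_ne_zero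
      (neg_ne_zero.2 (inv_ne_zero Real.pi_ne_zero)) z) =
      ∫ y, Complex.exp ((2 * inner ℝ (z.fst + y) z.snd : ℝ) * I) *
        (φ (z.fst + y) * f (z.fst - y)) := by
    rw [shortTimeCLM_apply, ← integral_add_left_eq_self _ z.fst]
    refine integral_congr_ae (ae_of_all _ fun y => ?_)
    simp only [phaseScale_fst, phaseScale_snd, inner_smul_right]
    have e1 : -(2 * Real.pi * (-Real.pi⁻¹ * inner ℝ (z.fst + y) z.snd)) =
        2 * inner ℝ (z.fst + y) z.snd := by
      field_simp
    have e2 : reflectCLM d f (z.fst + y - (2 : ℝ) • z.fst) = f (z.fst - y) := by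
      change f (-(z.fst + y - (2 : ℝ) • z.fst)) = _
      congr 1
      module
    rw [e1, e2]
  rw [h3, Complex.real_smul, ← h4] at h2
  push_cast at h2
  rw [h1, mul_left_comm, ← h2, ← integral_const_mul, crossWigner]
  refine integral_congr_ae (ae_of_all _ fun t => ?_)
  dsimp only
  rw [← mul_assoc, ← Complex.exp_add, mul_comm (φ _)]
  congr 2
  simp only [inner_add_left, inner_smul_left]
  push_cast
  simp
  ring

theorem crossWigner_swap (f φ : Config d → ℂ) (z : Phase d) :
    crossWigner f φ z = crossWigner φ f (WithLp.toLp 2 (z.fst, -z.snd)) := by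
  rw [crossWigner, ← integral_neg_eq_self, crossWigner]
  refine integral_congr_ae (ae_of_all _ fun t => ?_)
  change _ = Complex.exp ((inner ℝ t (-z.snd) : ℝ) * I) *
    (φ (z.fst - (1 / 2 : ℝ) • t) * f (z.fst + (1 / 2 : ℝ) • t))
  simp only [smul_neg, sub_neg_eq_add, ← sub_eq_add_neg, inner_neg_left, inner_neg_right]
  ring

/-- The (complex linear) map `φ ↦ conj (V_ψ (conj φ))`. -/
noncomputable def stftBarCLM (ψ : 𝓢(Config d, ℂ)) : 𝓢(Config d, ℂ) →L[ℂ] 𝓢(Phase d, ℂ) where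
  toFun φ := conjCLM _ (stftCLM ψ (conjCLM _ φ))
  map_add' φ₁ φ₂ := by simp
  map_smul' c φ := by
    have : conjCLM _ (c • φ) = (conj c) • conjCLM _ φ := by
      ext x; simp [conjCLM_apply]
    rw [this, map_smul]
    ext x; simp [conjCLM_apply]
  cont := (conjCLM _).continuous.comp ((stftCLM ψ).continuous.comp (conjCLM _).continuous)

/-- The standard Gaussian window `ψ₀ y = π^(-d/4) exp (-|y|²/2)`. -/
noncomputable def gaussianWindow (d : ℕ) : 𝓢(Config d, ℂ) :=
  ((Real.pi ^ (-(d : ℝ) / 4) : ℝ) : ℂ) • gaussianSchwartz (Config d) (b := 1 / 2) (by norm_num)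

theorem gaussianSchwartz_apply {V : Type*} [NormedAddCommGroup V] [InnerProductSpace ℝ V]
    {b : ℝ} (hb : 0 < b) (x : V) :
    gaussianSchwartz V hb x = (Real.exp (-b * ‖x‖ ^ 2) : ℂ) := rfl

theorem gaussianWindow_apply (y : Config d) :
    gaussianWindow d y = ((Real.pi ^ (-(d : ℝ) / 4) * Real.exp (-(1 / 2) * ‖y‖ ^ 2) : ℝ) : ℂ) := by
  rw [gaussianWindow, smul_apply, gaussianSchwartz_apply]
  simp

/-- A jointly given bilinear map `B : 𝓢 × 𝓢 → 𝓢(Phase d, ℂ)`, continuous in each argument (`B'` is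
`B` with the arguments exchanged), turns a tempered distribution `u` on phase space into the
operator `T : 𝓢 → 𝓢'` with `⟨T f, φ⟩ = ⟨u, B(f, φ)⟩`. -/
noncomputable def bilinearOp (B B' : 𝓢(Config d, ℂ) → 𝓢(Config d, ℂ) →L[ℂ] 𝓢(Phase d, ℂ))
    (h : ∀ f φ, B f φ = B' φ f) (u : 𝓢'(Phase d, ℂ)) :
    𝓢(Config d, ℂ) →L[ℂ] 𝓢'(Config d, ℂ) where
  toFun f := PointwiseConvergenceCLM.precomp ℂ (B f) u
  map_add' f g := by
    ext φ
    change u (B (f + g) φ) = u (B f φ) + u (B g φ)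
    rw [h, h, h, map_add, map_add]
  map_smul' c f := by
    ext φ
    change u (B (c • f) φ) = c • u (B f φ)
    rw [h, h, map_smul, map_smul]
  cont := by
    refine PointwiseConvergenceCLM.continuous_of_continuous_eval fun φ => ?_
    change Continuous fun f => u (B f φ)
    simp_rw [h]
    exact u.continuous.comp (B' φ).continuous

/-! ### Localization operators and Weyl quantization -/

/-- The map `φ ↦ V_{ψ₀} f · conj (V_{ψ₀} (conj φ))`. -/
noncomputable def stftProduct (f : 𝓢(Config d, ℂ)) : 𝓢(Config d, ℂ) →L[ℂ] 𝓢(Phase d, ℂ) :=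
  pairing (ContinuousLinearMap.mul ℂ ℂ) (stftCLM (gaussianWindow d) f) ∘L
    stftBarCLM (gaussianWindow d)

theorem stftProduct_swap (f φ : 𝓢(Config d, ℂ)) :
    stftProduct f φ = (pairing (ContinuousLinearMap.mul ℂ ℂ)
      (stftBarCLM (gaussianWindow d) φ) ∘L stftCLM (gaussianWindow d)) f := by
  ext z
  simp [stftProduct, mul_comm]

/-- The localization (anti-Wick) operator `A_a : 𝓢 → 𝓢'` of `a ∈ 𝓢'(ℝ^(2d))`. With the bilinear
pairing of Mathlib, `⟨A_a f, φ⟩ = (2π)^(-d) ⟨a, V_{ψ₀} f · conj (V_{ψ₀} (conj φ))⟩`, i.e.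
`(A_a f, g) = (2π)^(-d) (a V_{ψ₀} f, V_{ψ₀} g)` for the conjugate linear pairing
`(u, g) = ⟨u, conj g⟩`, see `localizationOp_apply_conj`. -/
noncomputable def localizationOp (a : 𝓢'(Phase d, ℂ)) :
    𝓢(Config d, ℂ) →L[ℂ] 𝓢'(Config d, ℂ) :=
  bilinearOp stftProduct _ stftProduct_swap (((2 * Real.pi : ℂ) ^ d)⁻¹ • a)

theorem localizationOp_apply_conj (a : 𝓢'(Phase d, ℂ)) (f g : 𝓢(Config d, ℂ)) :
    localizationOp a f (conjCLM _ g) = ((2 * Real.pi : ℂ) ^ d)⁻¹ *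
      a (pairing (ContinuousLinearMap.mul ℂ ℂ) (stftCLM (gaussianWindow d) f)
        (conjCLM _ (stftCLM (gaussianWindow d) g))) := by
  have h : conjCLM _ (conjCLM _ g) = g := by
    ext x
    simp [conjCLM_apply]
  change ((2 * Real.pi : ℂ) ^ d)⁻¹ * a (pairing (ContinuousLinearMap.mul ℂ ℂ)
    (stftCLM (gaussianWindow d) f) (conjCLM _ (stftCLM (gaussianWindow d)
      (conjCLM _ (conjCLM _ g))))) = _
  rw [h]

theorem wignerCLM_swap (f φ : 𝓢(Config d, ℂ)) :
    wignerCLM f φ = (compCLMOfContinuousLinearEquiv ℂ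
      (phaseScale d 1 (-1) one_ne_zero (neg_ne_zero.2 one_ne_zero)) ∘L wignerCLM φ) f := by
  ext z
  change _ = wignerCLM φ f (phaseScale d _ _ _ _ z)
  rw [wignerCLM_apply, wignerCLM_apply, crossWigner_swap]
  congr 1
  change _ = WithLp.toLp 2 ((1 : ℝ) • z.fst, (-1 : ℝ) • z.snd)
  rw [one_smul, neg_one_smul]

/-- The Weyl quantization `b^w(x, D) : 𝓢 → 𝓢'` of a tempered distribution `b`, in its weak
formulation `⟨b^w(x, D) f, φ⟩ = (2π)^(-d) ⟨b, W(f, φ)⟩`. Formally this is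
`b^w(x, D) f (x) = (2π)^(-d) ∬ exp (i (x - y)·ξ) b ((x + y)/2, ξ) f y dy dξ`, integrated against
`φ x` after the substitution `x = p + t/2`, `y = p - t/2`. -/
noncomputable def weylOp (b : 𝓢'(Phase d, ℂ)) : 𝓢(Config d, ℂ) →L[ℂ] 𝓢'(Config d, ℂ) :=
  bilinearOp wignerCLM _ wignerCLM_swap (((2 * Real.pi : ℂ) ^ d)⁻¹ • b)

theorem weylOp_apply (b : 𝓢'(Phase d, ℂ)) (f φ : 𝓢(Config d, ℂ)) :
    weylOp b f φ = ((2 * Real.pi : ℂ) ^ d)⁻¹ * b (wignerCLM f φ) := rfl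

/-! ### Convolution with the Gaussian -/

/-- The Gaussian `z ↦ π^(-d) exp (-|z|²)` on phase space. -/
noncomputable def phaseGaussian (d : ℕ) : 𝓢(Phase d, ℂ) :=
  ((Real.pi : ℂ) ^ d)⁻¹ • gaussianSchwartz (Phase d) one_pos

theorem phaseGaussian_apply (z : Phase d) :
    phaseGaussian d z = ((Real.pi : ℂ) ^ d)⁻¹ * (Real.exp (-‖z‖ ^ 2) : ℂ) := by
  rw [phaseGaussian, smul_apply, gaussianSchwartz_apply, smul_eq_mul, neg_one_mul]

/-- The convolution `π^(-d) exp (-|·|²) * a` for a function `a`. -/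
noncomputable def gaussConv (a : Phase d → ℂ) (z : Phase d) : ℂ :=
  ∫ w, phaseGaussian d w * a (z - w)

theorem convolution_phaseGaussian_apply (φ : 𝓢(Phase d, ℂ)) (z : Phase d) :
    convolution (ContinuousLinearMap.mul ℂ ℂ) (phaseGaussian d) φ z = gaussConv φ z := by
  rw [convolution_apply]
  rfl

/-- The convolution `π^(-d) exp (-|·|²) * a` for a tempered distribution `a`, defined by duality:
`⟨g * a, φ⟩ = ⟨a, g * φ⟩` (the Gaussian `g` is even). -/
noncomputable def gaussConvDist (a : 𝓢'(Phase d, ℂ)) : 𝓢'(Phase d, ℂ) :=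
  PointwiseConvergenceCLM.precomp ℂ
    (convolution (ContinuousLinearMap.mul ℂ ℂ) (phaseGaussian d)) a

/-! ### Shubin symbols -/

/-- The Japanese bracket `⟨z⟩ = (1 + |z|²)^(1/2)`. -/
noncomputable def japanese (z : Phase d) : ℝ := Real.sqrt (1 + ‖z‖ ^ 2)

/-- Multi-indices in `ℕ^(2d)`: `inl` indexes the `x` variables and `inr` the `ξ` variables. -/
abbrev MultiIndex (d : ℕ) := Fin d ⊕ Fin d → ℕ

/-- The length `|α|`. -/
def MultiIndex.length (α : MultiIndex d) : ℕ := ∑ i, α i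

/-- The standard basis of phase space. -/
noncomputable def phaseBasis : Fin d ⊕ Fin d → Phase d
  | .inl j => WithLp.toLp 2 (EuclideanSpace.single j 1, 0)
  | .inr j => WithLp.toLp 2 (0, EuclideanSpace.single j 1)

/-- The partial derivative in the `i`-th coordinate. -/
noncomputable def partialDeriv (i : Fin d ⊕ Fin d) (a : Phase d → ℂ) : Phase d → ℂ :=
  fun z => lineDeriv ℝ a z (phaseBasis i)

/-- The partial derivative `∂^α = ∂_x^{α'} ∂_ξ^{α''}`, where `α = (α', α'')`. -/
noncomputable def multiDeriv (α : MultiIndex d) (a : Phase d → ℂ) : Phase d → ℂ :=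
  (List.finRange d).foldr (fun j g => (partialDeriv (.inl j))^[α (.inl j)] g)
    ((List.finRange d).foldr (fun j g => (partialDeriv (.inr j))^[α (.inr j)] g) a)

/-- The class `G^m` of Shubin symbols of order `m`. -/
def shubinClass (d : ℕ) (m : ℝ) : Set (Phase d → ℂ) :=
  {a | ContDiff ℝ ∞ a ∧ ∀ α : MultiIndex d, ∃ C : ℝ, 0 < C ∧ ∀ z : Phase d,
    ‖multiDeriv α a z‖ ≤ C * japanese z ^ (m - (α.length : ℝ))}

/-- `b ∼ ∑_α A_α` for a family of symbols `A_α ∈ G^(m - |α|)`: all remainders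
`b - ∑_{|α| < n} A_α`, `n ≥ 1`, belong to `G^(m - n)`. -/
def HasAsymptoticExpansion (m : ℝ) (b : Phase d → ℂ) (A : MultiIndex d → Phase d → ℂ) : Prop :=
  (∀ α, A α ∈ shubinClass d (m - (α.length : ℝ))) ∧
    ∀ n : ℕ, 1 ≤ n →
      b - ∑ k ∈ Finset.range n, ∑ α ∈ Finset.univ.piAntidiag k, A α ∈ shubinClass d (m - (n : ℝ))

/-- Open conic subsets of `T*ℝ^d ∖ 0`. -/
def IsOpenCone (Γ : Set (Phase d)) : Prop :=
  IsOpen Γ ∧ (0 : Phase d) ∉ Γ ∧ ∀ z ∈ Γ, ∀ t : ℝ, 0 < t → t • z ∈ Γ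

/-- `z₀` is non-hypercharacteristic of order `m'` for `a`: in an open cone around `z₀` and for
large `|z|`, `|a(z)| ≥ C ⟨z⟩^m'` and `|∂^α a(z)| ≤ C_α |a(z)| ⟨z⟩^(-|α|)`. -/
def NonHyperchar (m' : ℝ) (a : Phase d → ℂ) (z₀ : Phase d) : Prop :=
  ∃ Γ : Set (Phase d), IsOpenCone Γ ∧ z₀ ∈ Γ ∧
    ∃ (A C : ℝ) (K : MultiIndex d → ℝ), 0 < A ∧ 0 < C ∧ (∀ α, 0 < K α) ∧
      ∀ z ∈ Γ, A ≤ ‖z‖ →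
        C * japanese z ^ m' ≤ ‖a z‖ ∧
        ∀ α, ‖multiDeriv α a z‖ ≤ K α * ‖a z‖ * japanese z ^ (-(α.length : ℝ))

/-- The hypercharacteristic set `char_{m'}(a) ⊆ T*ℝ^d ∖ 0`. -/
def hypercharSet (m' : ℝ) (a : Phase d → ℂ) : Set (Phase d) :=
  {z | z ≠ 0 ∧ ¬ NonHyperchar m' a z}

/-- The microsupport `μsupp(a) ⊆ T*ℝ^d ∖ 0`: `z₀ ∉ μsupp(a)` if all derivatives of `a` decrease
rapidly in an open cone around `z₀`. -/
def microSupport (a : Phase d → ℂ) : Set (Phase d) :=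
  {z₀ | z₀ ≠ 0 ∧ ¬ ∃ Γ : Set (Phase d), IsOpenCone Γ ∧ z₀ ∈ Γ ∧
    ∀ (α : MultiIndex d) (N : ℝ), 0 ≤ N →
      ∃ C : ℝ, ∀ z ∈ Γ, japanese z ^ N * ‖multiDeriv α a z‖ ≤ C}

end

end WeylWick

open WeylWick
open scoped SchwartzMap

/-!
The first assertion is an identity of test functions. Both operators pair a distribution with a
Schwartz function on phase space, the product `V_{ψ₀} f · conj (V_{ψ₀} (conj φ))` for `A_a` and the
Wigner transform `W(f, φ)` for the Weyl operator, and the former is the convolution of the latter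
with `g = π^(-d) exp (-|·|²)` (`stftProduct_eq_convolution`). Indeed, in the variables `y` and
`t = y' - y` of the double integral of `f y φ y'` defining the product, the two Gaussian windows
combine to a Gaussian in the midpoint, which is the position part of `g`, and a Gaussian in `t`,
which is the Fourier transform of the frequency part of `g`.

For a symbol `a`, insert the Taylor expansion of `a (z - w)` at `z` into `b z = ∫ g w * a (z - w)
dw`. The terms of degree `k` integrate to `∑_{|α| = k} c_α ∂^α a z`, where `c_α` is a sum of
moments of `g`, divided by `k!`. By Peetre's inequality the Taylor remainder of order `n` is at
most `C (1 + |w|)^K ⟨z⟩^(m - n)`, and the Gaussian integrates the polynomial in `w`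
(`exists_norm_gaussConv_sub_le`). The convolution commutes with derivatives, so the same estimate
for `∂^β a ∈ G^(m - |β|)` controls the derivatives of the remainder. The order `n = 0` is the
statement `b ∈ G^m`.

The inclusions of the characteristic sets and of the microsupports follow from the expansion alone,
in the cone given for `a`. If `a` satisfies the lower bound and the derivative estimates there,
every term with `α ≠ 0` and the remainder of high order are `O(|a| ⟨z⟩⁻¹)`, hence `|b| ≥ |a| / 2`
far out (`nonHyperchar_gaussConv`). If all derivatives of `a` decrease rapidly, so do all terms,
and the remainder decreases at any prescribed rate (`rapidDecrease_gaussConv`).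
-/

namespace WeylWick

open MeasureTheory SchwartzMap FourierTransform Complex
open scoped ContDiff ComplexConjugate

/-! ### Convolution of a Schwartz function with a function of temperate growth -/

section Smoothing

universe u

theorem norm_smul_sub_le {E F : Type*} [NormedAddCommGroup E] [NormedSpace ℝ E]
    [NormedAddCommGroup F] [NormedSpace ℂ F] (g : 𝓢(E, ℂ)) {f : E → F} {C : ℝ} {k : ℕ} (hC : 0 ≤ C)
    (hf : ∀ z, ‖f z‖ ≤ C * (1 + ‖z‖) ^ k) {R : ℝ} {z : E} (hz : ‖z‖ ≤ R) (w : E) :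
    ‖g w • f (z - w)‖ ≤ C * (1 + R) ^ k * ((1 + ‖w‖) ^ k * ‖g w‖) := by
  have hR : 0 ≤ R := (norm_nonneg z).trans hz
  have h1 : 1 + ‖z - w‖ ≤ (1 + R) * (1 + ‖w‖) := by
    nlinarith [norm_sub_le z w, norm_nonneg w]
  calc ‖g w • f (z - w)‖ ≤ ‖g w‖ * (C * (1 + ‖z - w‖) ^ k) := by
        rw [norm_smul]; gcongr; exact hf _
    _ ≤ ‖g w‖ * (C * ((1 + R) * (1 + ‖w‖)) ^ k) := by gcongr
    _ = _ := by rw [mul_pow]; ring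

theorem HasTemperateGrowth.fderiv {E F : Type*} [NormedAddCommGroup E] [NormedSpace ℝ E]
    [NormedAddCommGroup F] [NormedSpace ℝ F] {f : E → F} (hf : f.HasTemperateGrowth) :
    (_root_.fderiv ℝ f).HasTemperateGrowth := by
  refine ⟨hf.1.fderiv_right (m := ∞) le_rfl, fun n => ?_⟩
  obtain ⟨k, C, h⟩ := hf.2 (n + 1)
  exact ⟨k, C, fun x => by rw [norm_iteratedFDeriv_fderiv]; exact h x⟩

variable {E : Type*} [NormedAddCommGroup E] [InnerProductSpace ℝ E] [FiniteDimensional ℝ E]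
  [MeasurableSpace E] [BorelSpace E]

theorem integrable_one_add_norm_pow_mul (g : 𝓢(E, ℂ)) (k : ℕ) :
    Integrable (fun w => (1 + ‖w‖) ^ k * ‖g w‖) := by
  have h0 := (g.integrable_pow_mul volume 0).add (g.integrable_pow_mul volume k)
  refine (h0.const_mul (2 ^ (k - 1))).mono' (by fun_prop) (ae_of_all _ fun w => ?_)
  rw [Real.norm_of_nonneg (by positivity), Pi.add_apply, ← add_mul, ← mul_assoc]
  gcongr
  simpa using add_pow_le zero_le_one (norm_nonneg w) k

/-- The convolution of a scalar function with a vector valued one. Vector values are needed because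
the derivative of a convolution is the convolution with the Fréchet derivative. -/
noncomputable def smoothing {F : Type*} [NormedAddCommGroup F] [NormedSpace ℝ F] [NormedSpace ℂ F]
    (g : 𝓢(E, ℂ)) (f : E → F) (z : E) : F :=
  ∫ w, g w • f (z - w)

variable {F : Type*} [NormedAddCommGroup F] [NormedSpace ℝ F] [NormedSpace ℂ F]

theorem integrable_smul_sub (g : 𝓢(E, ℂ)) {f : E → F} (hf : f.HasTemperateGrowth) (z : E) :
    Integrable (fun w => g w • f (z - w)) := by
  obtain ⟨k, C, hC, h⟩ := hf.norm_iteratedFDeriv_le_uniform 0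
  have hc : Continuous f := hf.1.continuous
  refine ((integrable_one_add_norm_pow_mul g k).const_mul (C * (1 + ‖z‖) ^ k)).mono'
    (by fun_prop) (ae_of_all _ fun w => ?_)
  exact norm_smul_sub_le g hC (fun z => by simpa using h 0 le_rfl z) le_rfl w

theorem hasFDerivAt_smoothing (g : 𝓢(E, ℂ)) {f : E → F}
    (hf : f.HasTemperateGrowth) (z : E) :
    HasFDerivAt (smoothing g f) (smoothing g (fderiv ℝ f) z) z := by
  have hf' := HasTemperateGrowth.fderiv hf
  obtain ⟨k, C, hC, h⟩ := hf'.norm_iteratedFDeriv_le_uniform 0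
  have hb : ∀ {x : E}, ‖x‖ ≤ ‖z‖ + 1 → ∀ w, _ := fun hx =>
    norm_smul_sub_le g hC (fun z => by simpa using h 0 le_rfl z) hx
  have hc : Continuous f := hf.1.continuous
  refine hasFDerivAt_integral_of_dominated_of_fderiv_le (𝕜 := ℝ) (μ := volume)
    (bound := fun w => C * (1 + (‖z‖ + 1)) ^ k * ((1 + ‖w‖) ^ k * ‖g w‖))
    (F := fun x w => g w • f (x - w)) (F' := fun x w => g w • fderiv ℝ f (x - w))
    (Metric.ball_mem_nhds z one_pos) (Filter.Eventually.of_forall fun x => ?_)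
    (integrable_smul_sub g hf z) (integrable_smul_sub g hf' z).1 (ae_of_all _ fun w x hx => ?_)
    ((integrable_one_add_norm_pow_mul g k).const_mul _) (ae_of_all _ fun w x _ => ?_)
  · exact (integrable_smul_sub g hf x).1
  · refine hb ?_ w
    have := norm_sub_norm_le x z
    rw [Metric.mem_ball, dist_eq_norm] at hx
    linarith
  · have h1 : HasFDerivAt f (fderiv ℝ f (x - w)) (x - w) :=
      (hf.1.differentiable (by simp) _).hasFDerivAt
    exact (h1.comp x ((hasFDerivAt_id x).sub_const w)).const_smul (g w)

theorem fderiv_smoothing (g : 𝓢(E, ℂ)) {f : E → F}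
    (hf : f.HasTemperateGrowth) : fderiv ℝ (smoothing g f) = smoothing g (fderiv ℝ f) :=
  funext fun z => (hasFDerivAt_smoothing g hf z).fderiv

theorem contDiff_smoothing {E F : Type u} [NormedAddCommGroup E] [InnerProductSpace ℝ E]
    [FiniteDimensional ℝ E] [MeasurableSpace E] [BorelSpace E] [NormedAddCommGroup F]
    [NormedSpace ℝ F] [NormedSpace ℂ F] (g : 𝓢(E, ℂ)) {f : E → F}
    (hf : f.HasTemperateGrowth) : ContDiff ℝ ∞ (smoothing g f) := by
  refine contDiff_infty.2 fun n => ?_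
  induction n generalizing F with
  | zero =>
    exact contDiff_zero.2 (continuous_iff_continuousAt.2 fun z =>
      (hasFDerivAt_smoothing g hf z).continuousAt)
  | succ n ih =>
    rw [Nat.cast_succ, contDiff_succ_iff_fderiv]
    refine ⟨fun z => (hasFDerivAt_smoothing g hf z).differentiableAt, by simp, ?_⟩
    rw [fderiv_smoothing g hf]
    exact ih (HasTemperateGrowth.fderiv hf)

end Smoothing

section

variable {d : ℕ}

theorem gaussConv_eq_smoothing (a : Phase d → ℂ) : gaussConv a = smoothing (phaseGaussian d) a :=
  rfl

theorem contDiff_gaussConv {a : Phase d → ℂ} (ha : a.HasTemperateGrowth) :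
    ContDiff ℝ ∞ (gaussConv a) :=
  contDiff_smoothing _ ha

theorem partialDeriv_eq_fderiv {a : Phase d → ℂ} (ha : ContDiff ℝ ∞ a) (i : Fin d ⊕ Fin d)
    (z : Phase d) : partialDeriv i a z = fderiv ℝ a z (phaseBasis i) :=
  (ha.differentiable (by simp) z).lineDeriv_eq_fderiv

theorem partialDeriv_gaussConv {a : Phase d → ℂ} (ha : a.HasTemperateGrowth)
    (i : Fin d ⊕ Fin d) : partialDeriv i (gaussConv a) = gaussConv (partialDeriv i a) := by
  funext z
  rw [partialDeriv_eq_fderiv (contDiff_gaussConv ha), gaussConv_eq_smoothing,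
    fderiv_smoothing _ ha, smoothing, ContinuousLinearMap.integral_apply
    (integrable_smul_sub _ (HasTemperateGrowth.fderiv ha) z)]
  refine integral_congr_ae (ae_of_all _ fun w => ?_)
  change phaseGaussian d w • fderiv ℝ a (z - w) (phaseBasis i) = _
  rw [← partialDeriv_eq_fderiv ha.1]
  rfl

/-! ### Partial derivatives along words and multi-indices -/

/-- The coordinates of a phase space point in the basis `phaseBasis`. -/
def phaseCoord (v : Phase d) : Fin d ⊕ Fin d → ℝ :=
  Sum.elim v.fst v.snd

theorem sum_phaseCoord_smul (v : Phase d) : ∑ i, phaseCoord v i • phaseBasis i = v := by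
  have h : ∀ x : Config d, ∑ j, x j • EuclideanSpace.single j (1 : ℝ) = x := by
    intro x
    ext j
    simp [Pi.single_apply]
  apply (WithLp.equiv 2 _).injective
  refine Prod.ext ?_ ?_ <;>
    simp [Fintype.sum_sum_type, phaseCoord, phaseBasis, Prod.fst_sum, Prod.snd_sum, h]

theorem abs_phaseCoord_le (v : Phase d) (i : Fin d ⊕ Fin d) : |phaseCoord v i| ≤ ‖v‖ := by
  cases i with
  | inl j => exact (PiLp.norm_apply_le v.fst j).trans (WithLp.norm_fst_le (p := 2) _ v)
  | inr j => exact (PiLp.norm_apply_le v.snd j).trans (WithLp.norm_snd_le (p := 2) _ v)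

theorem continuous_phaseCoord (i : Fin d ⊕ Fin d) : Continuous fun v => phaseCoord v i := by
  cases i with
  | inl j => exact (EuclideanSpace.proj j).continuous.comp (WithLp.fstL 2 ℝ _ _).continuous
  | inr j => exact (EuclideanSpace.proj j).continuous.comp (WithLp.sndL 2 ℝ _ _).continuous

/-- The iterated partial derivative along a word in the `2d` coordinates, the head of the word
being the outermost derivative. Words record the order of differentiation, which multi-indices
forget; this makes them the convenient index set for induction and for Taylor expansions. -/
noncomputable def wordDeriv (w : List (Fin d ⊕ Fin d)) (a : Phase d → ℂ) : Phase d → ℂ :=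
  w.foldr partialDeriv a

theorem wordDeriv_cons (i : Fin d ⊕ Fin d) (w : List (Fin d ⊕ Fin d)) (a : Phase d → ℂ) :
    wordDeriv (i :: w) a = partialDeriv i (wordDeriv w a) := rfl

theorem wordDeriv_append (v w : List (Fin d ⊕ Fin d)) (a : Phase d → ℂ) :
    wordDeriv (v ++ w) a = wordDeriv v (wordDeriv w a) :=
  List.foldr_append

theorem contDiff_partialDeriv {a : Phase d → ℂ} (ha : ContDiff ℝ ∞ a) (i : Fin d ⊕ Fin d) :
    ContDiff ℝ ∞ (partialDeriv i a) := by
  have h : partialDeriv i a = fun z => fderiv ℝ a z (phaseBasis i) :=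
    funext (partialDeriv_eq_fderiv ha i)
  rw [h]
  exact (ha.fderiv_right (m := ∞) le_rfl).clm_apply contDiff_const

theorem contDiff_wordDeriv {a : Phase d → ℂ} (ha : ContDiff ℝ ∞ a) (w : List (Fin d ⊕ Fin d)) :
    ContDiff ℝ ∞ (wordDeriv w a) := by
  induction w with
  | nil => exact ha
  | cons i w ih => exact contDiff_partialDeriv ih i

theorem iteratedFDeriv_phaseBasis {a : Phase d → ℂ} (ha : ContDiff ℝ ∞ a) {k : ℕ}
    (r : Fin k → Fin d ⊕ Fin d) (z : Phase d) :
    iteratedFDeriv ℝ k a z (fun j => phaseBasis (r j)) = wordDeriv (List.ofFn r) a z := by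
  induction k generalizing z with
  | zero => simp [wordDeriv]
  | succ k ih =>
    have hd : DifferentiableAt ℝ (iteratedFDeriv ℝ k a) z :=
      (ha.differentiable_iteratedFDeriv (mod_cast ENat.natCast_lt_top k)) z
    rw [iteratedFDeriv_succ_apply_left, List.ofFn_succ, wordDeriv_cons,
      partialDeriv_eq_fderiv (contDiff_wordDeriv ha _),
      ← funext (ih fun j => r j.succ), fderiv_continuousMultilinear_apply_const hd]
    rfl

theorem iteratedFDeriv_apply_eq_sum {a : Phase d → ℂ} (ha : ContDiff ℝ ∞ a) {k : ℕ} (z : Phase d)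
    (v : Fin k → Phase d) :
    iteratedFDeriv ℝ k a z v = ∑ r : Fin k → Fin d ⊕ Fin d,
      (∏ j, phaseCoord (v j) (r j)) • wordDeriv (List.ofFn r) a z := by
  have h : v = fun j => ∑ i, phaseCoord (v j) i • phaseBasis i :=
    funext fun j => (sum_phaseCoord_smul (v j)).symm
  conv_lhs => rw [h]
  rw [ContinuousMultilinearMap.map_sum]
  refine Finset.sum_congr rfl fun r _ => ?_
  rw [ContinuousMultilinearMap.map_smul_univ, iteratedFDeriv_phaseBasis ha]

theorem norm_iteratedFDeriv_le_sum {a : Phase d → ℂ} (ha : ContDiff ℝ ∞ a) (k : ℕ) (z : Phase d) :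
    ‖iteratedFDeriv ℝ k a z‖ ≤
      ∑ r : Fin k → Fin d ⊕ Fin d, ‖wordDeriv (List.ofFn r) a z‖ := by
  refine ContinuousMultilinearMap.opNorm_le_bound (by positivity) fun v => ?_
  rw [iteratedFDeriv_apply_eq_sum ha, Finset.sum_mul]
  refine (norm_sum_le _ _).trans (Finset.sum_le_sum fun r _ => ?_)
  rw [norm_smul, norm_prod, mul_comm]
  gcongr
  exact abs_phaseCoord_le _ _

theorem partialDeriv_comm {a : Phase d → ℂ} (ha : ContDiff ℝ ∞ a) (i j : Fin d ⊕ Fin d) :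
    partialDeriv i (partialDeriv j a) = partialDeriv j (partialDeriv i a) := by
  have h : ∀ i j : Fin d ⊕ Fin d, ∀ z, partialDeriv i (partialDeriv j a) z =
      fderiv ℝ (fderiv ℝ a) z (phaseBasis i) (phaseBasis j) := by
    intro i j z
    rw [partialDeriv_eq_fderiv (contDiff_partialDeriv ha j), funext (partialDeriv_eq_fderiv ha j),
      fderiv_clm_apply ((ha.fderiv_right (m := ∞) le_rfl).differentiable (by simp) z)
      (differentiableAt_const _)]
    simp
  funext z
  rw [h, h]
  exact ((contDiff_infty.1 ha 2).contDiffAt.isSymmSndFDerivAt (by simp)) _ _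

theorem wordDeriv_perm {a : Phase d → ℂ} (ha : ContDiff ℝ ∞ a) {v w : List (Fin d ⊕ Fin d)}
    (h : v.Perm w) : wordDeriv v a = wordDeriv w a := by
  induction h with
  | nil => rfl
  | cons i _ ih => rw [wordDeriv_cons, wordDeriv_cons, ih]
  | swap i j w => exact partialDeriv_comm (contDiff_wordDeriv ha w) _ _
  | trans _ _ h₁ h₂ => exact h₁.trans h₂

/-- The word in which the coordinate `i` occurs `α i` times, in the order in which `multiDeriv`
takes the derivatives. -/
def multiWord (α : MultiIndex d) : List (Fin d ⊕ Fin d) :=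
  ((List.finRange d).flatMap fun j => List.replicate (α (.inl j)) (.inl j)) ++
    (List.finRange d).flatMap fun j => List.replicate (α (.inr j)) (.inr j)

theorem wordDeriv_replicate (n : ℕ) (i : Fin d ⊕ Fin d) (a : Phase d → ℂ) :
    wordDeriv (List.replicate n i) a = (partialDeriv i)^[n] a := by
  induction n with
  | zero => rfl
  | succ n ih => rw [List.replicate_succ, wordDeriv_cons, ih, Function.iterate_succ_apply']

theorem multiDeriv_eq_wordDeriv (α : MultiIndex d) (a : Phase d → ℂ) :
    multiDeriv α a = wordDeriv (multiWord α) a := by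
  have h : ∀ (l : List (Fin d)) (f : Fin d → Fin d ⊕ Fin d) (a : Phase d → ℂ),
      l.foldr (fun j g => (partialDeriv (f j))^[α (f j)] g) a =
        wordDeriv (l.flatMap fun j => List.replicate (α (f j)) (f j)) a := by
    intro l f a
    induction l with
    | nil => rfl
    | cons j l ih =>
      rw [List.foldr_cons, ih, List.flatMap_cons, wordDeriv_append, wordDeriv_replicate]
  rw [multiDeriv, h _ Sum.inl, h _ Sum.inr, multiWord, wordDeriv_append]

theorem length_multiWord (α : MultiIndex d) : (multiWord α).length = α.length := by
  simp [multiWord, MultiIndex.length, Fintype.sum_sum_type, List.length_flatMap, Fin.sum_univ_def]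

theorem count_multiWord (α : MultiIndex d) (i : Fin d ⊕ Fin d) :
    (multiWord α : Multiset (Fin d ⊕ Fin d)).count i = α i := by
  rw [Multiset.coe_count]
  cases i <;>
    simp [multiWord, List.count_flatMap, List.count_replicate, Function.comp_def,
      ← Fin.sum_univ_def]

/-- The multi-index counting the letters of a word. -/
def wordCount (w : List (Fin d ⊕ Fin d)) : MultiIndex d :=
  fun i => (w : Multiset (Fin d ⊕ Fin d)).count i

theorem multiWord_wordCount_perm (w : List (Fin d ⊕ Fin d)) : (multiWord (wordCount w)).Perm w :=
  Multiset.coe_eq_coe.1 (Multiset.ext.2 fun i => count_multiWord _ i)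

theorem length_wordCount (w : List (Fin d ⊕ Fin d)) : (wordCount w).length = w.length := by
  rw [← length_multiWord, (multiWord_wordCount_perm w).length_eq]

theorem wordDeriv_eq_multiDeriv {a : Phase d → ℂ} (ha : ContDiff ℝ ∞ a)
    (w : List (Fin d ⊕ Fin d)) : wordDeriv w a = multiDeriv (wordCount w) a := by
  rw [multiDeriv_eq_wordDeriv, wordDeriv_perm ha (multiWord_wordCount_perm w)]

theorem wordDeriv_comm {a : Phase d → ℂ} (ha : ContDiff ℝ ∞ a) (v w : List (Fin d ⊕ Fin d)) :
    wordDeriv v (wordDeriv w a) = wordDeriv w (wordDeriv v a) := by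
  rw [← wordDeriv_append, ← wordDeriv_append]
  exact wordDeriv_perm ha List.perm_append_comm

theorem partialDeriv_add {a b : Phase d → ℂ} (ha : ContDiff ℝ ∞ a) (hb : ContDiff ℝ ∞ b)
    (i : Fin d ⊕ Fin d) : partialDeriv i (a + b) = partialDeriv i a + partialDeriv i b := by
  funext z
  have hab : ContDiff ℝ ∞ (a + b) := ha.add hb
  rw [Pi.add_apply, partialDeriv_eq_fderiv hab, partialDeriv_eq_fderiv ha,
    partialDeriv_eq_fderiv hb, fderiv_add (ha.differentiable (by simp) z)
    (hb.differentiable (by simp) z)]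
  rfl

theorem contDiff_complex_smul {a : Phase d → ℂ} (ha : ContDiff ℝ ∞ a) (c : ℂ) :
    ContDiff ℝ ∞ (c • a) :=
  contDiff_const.smul ha

theorem partialDeriv_const_smul {a : Phase d → ℂ} (ha : ContDiff ℝ ∞ a) (c : ℂ)
    (i : Fin d ⊕ Fin d) : partialDeriv i (c • a) = c • partialDeriv i a := by
  funext z
  rw [Pi.smul_apply, partialDeriv_eq_fderiv (contDiff_complex_smul ha c), partialDeriv_eq_fderiv ha,
    fderiv_const_smul (ha.differentiable (by simp) z)]
  rfl

theorem wordDeriv_add {a b : Phase d → ℂ} (ha : ContDiff ℝ ∞ a) (hb : ContDiff ℝ ∞ b)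
    (w : List (Fin d ⊕ Fin d)) : wordDeriv w (a + b) = wordDeriv w a + wordDeriv w b := by
  induction w with
  | nil => rfl
  | cons i w ih =>
    rw [wordDeriv_cons, ih, partialDeriv_add (contDiff_wordDeriv ha w) (contDiff_wordDeriv hb w)]
    rfl

theorem wordDeriv_const_smul {a : Phase d → ℂ} (ha : ContDiff ℝ ∞ a) (c : ℂ)
    (w : List (Fin d ⊕ Fin d)) : wordDeriv w (c • a) = c • wordDeriv w a := by
  induction w with
  | nil => rfl
  | cons i w ih =>
    rw [wordDeriv_cons, ih, partialDeriv_const_smul (contDiff_wordDeriv ha w)]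
    rfl

theorem wordDeriv_zero (w : List (Fin d ⊕ Fin d)) : wordDeriv w (0 : Phase d → ℂ) = 0 := by
  simpa using wordDeriv_const_smul (d := d) (a := 0) contDiff_const 0 w

theorem wordDeriv_sub {a b : Phase d → ℂ} (ha : ContDiff ℝ ∞ a) (hb : ContDiff ℝ ∞ b)
    (w : List (Fin d ⊕ Fin d)) : wordDeriv w (a - b) = wordDeriv w a - wordDeriv w b := by
  have h : a - b = a + (-1 : ℂ) • b := by rw [neg_one_smul, sub_eq_add_neg]
  rw [h, wordDeriv_add ha (contDiff_complex_smul hb _), wordDeriv_const_smul hb, neg_one_smul,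
    sub_eq_add_neg]

theorem contDiff_finset_sum {ι : Type*} (s : Finset ι) {f : ι → Phase d → ℂ}
    (hf : ∀ k ∈ s, ContDiff ℝ ∞ (f k)) : ContDiff ℝ ∞ (∑ k ∈ s, f k) := by
  have h : ∑ k ∈ s, f k = fun z => ∑ k ∈ s, f k z := funext fun z => Finset.sum_apply _ _ _
  rw [h]
  exact ContDiff.sum hf

theorem wordDeriv_sum {ι : Type*} (s : Finset ι) {f : ι → Phase d → ℂ}
    (hf : ∀ k ∈ s, ContDiff ℝ ∞ (f k)) (w : List (Fin d ⊕ Fin d)) :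
    wordDeriv w (∑ k ∈ s, f k) = ∑ k ∈ s, wordDeriv w (f k) := by
  classical
  induction s using Finset.induction_on with
  | empty => exact wordDeriv_zero w
  | insert k s hk ih =>
    rw [Finset.sum_insert hk, Finset.sum_insert hk, wordDeriv_add (hf k (s.mem_insert_self k))
      (contDiff_finset_sum s fun j hj => hf j (Finset.mem_insert_of_mem hj)),
      ih fun j hj => hf j (Finset.mem_insert_of_mem hj)]

/-! ### Shubin symbols -/

theorem one_le_japanese (z : Phase d) : 1 ≤ japanese z :=
  Real.one_le_sqrt.2 (by nlinarith [sq_nonneg ‖z‖])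

theorem japanese_pos (z : Phase d) : 0 < japanese z := one_pos.trans_le (one_le_japanese z)

theorem norm_le_japanese (z : Phase d) : ‖z‖ ≤ japanese z :=
  Real.le_sqrt_of_sq_le (by linarith)

theorem japanese_le_one_add_norm (z : Phase d) : japanese z ≤ 1 + ‖z‖ :=
  Real.sqrt_le_iff.2 ⟨by positivity, by nlinarith [norm_nonneg z]⟩

theorem japanese_neg (z : Phase d) : japanese (-z) = japanese z := by
  rw [japanese, norm_neg, japanese]

theorem japanese_add_le (z w : Phase d) : japanese (z + w) ≤ 2 * japanese w * japanese z := by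
  refine Real.sqrt_le_iff.2 ⟨by have := japanese_pos z; have := japanese_pos w; positivity, ?_⟩
  rw [mul_pow, mul_pow, japanese, japanese, Real.sq_sqrt (by positivity),
    Real.sq_sqrt (by positivity)]
  have h1 : ‖z + w‖ ^ 2 ≤ (‖z‖ + ‖w‖) ^ 2 := by gcongr; exact norm_add_le z w
  nlinarith [sq_nonneg (‖z‖ - ‖w‖), sq_nonneg (‖z‖ * ‖w‖)]

/-- Peetre's inequality, with a polynomial weight. -/
theorem exists_peetre (d : ℕ) (s : ℝ) : ∃ k : ℕ, ∀ z w : Phase d,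
    japanese (z - w) ^ s ≤ 2 ^ k * (1 + ‖w‖) ^ k * japanese z ^ s := by
  refine ⟨⌈|s|⌉₊, fun z w => ?_⟩
  have hz := japanese_pos z
  have hw := japanese_pos w
  have hzw := japanese_pos (z - w)
  have h1 : (2 * japanese w) ^ |s| ≤ 2 ^ ⌈|s|⌉₊ * (1 + ‖w‖) ^ ⌈|s|⌉₊ := by
    have h2 : 1 ≤ 2 * (1 + ‖w‖) := by linarith [norm_nonneg w]
    calc (2 * japanese w) ^ |s| ≤ (2 * (1 + ‖w‖)) ^ |s| := by
          gcongr; exact japanese_le_one_add_norm w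
      _ ≤ (2 * (1 + ‖w‖)) ^ (⌈|s|⌉₊ : ℝ) := Real.rpow_le_rpow_of_exponent_le h2 (Nat.le_ceil _)
      _ = _ := by rw [Real.rpow_natCast, mul_pow]
  refine le_trans ?_ (mul_le_mul_of_nonneg_right h1 (by positivity))
  rcases le_total 0 s with hs | hs
  · rw [abs_of_nonneg hs, ← Real.mul_rpow (by positivity) hz.le, sub_eq_add_neg]
    gcongr
    rw [← japanese_neg w]
    exact japanese_add_le z (-w)
  · have h3 : japanese z ≤ 2 * japanese w * japanese (z - w) := by
      simpa using japanese_add_le (z - w) w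
    have h4 := Real.rpow_le_rpow_of_nonpos hz h3 hs
    rw [Real.mul_rpow (by positivity) hzw.le] at h4
    rw [abs_of_nonpos hs, Real.rpow_neg (by positivity), inv_mul_eq_div,
      le_div_iff₀ (by positivity), mul_comm]
    exact h4

theorem shubinClass_iff_wordDeriv {m : ℝ} {a : Phase d → ℂ} :
    a ∈ shubinClass d m ↔ ContDiff ℝ ∞ a ∧ ∀ w : List (Fin d ⊕ Fin d), ∃ C : ℝ, 0 < C ∧
      ∀ z, ‖wordDeriv w a z‖ ≤ C * japanese z ^ (m - (w.length : ℝ)) := by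
  refine and_congr_right fun ha => ⟨fun h w => ?_, fun h α => ?_⟩
  · rw [wordDeriv_eq_multiDeriv ha, ← length_wordCount]
    exact h _
  · rw [multiDeriv_eq_wordDeriv, ← length_multiWord]
    exact h _

theorem wordDeriv_mem_shubinClass {m : ℝ} {a : Phase d → ℂ} (ha : a ∈ shubinClass d m)
    (w : List (Fin d ⊕ Fin d)) : wordDeriv w a ∈ shubinClass d (m - (w.length : ℝ)) := by
  rw [shubinClass_iff_wordDeriv] at ha ⊢
  refine ⟨contDiff_wordDeriv ha.1 w, fun v => ?_⟩
  obtain ⟨C, hC, h⟩ := ha.2 (v ++ w)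
  refine ⟨C, hC, fun z => ?_⟩
  rw [← wordDeriv_append, sub_sub, add_comm (w.length : ℝ), ← Nat.cast_add, ← List.length_append]
  exact h z

theorem multiDeriv_mem_shubinClass {m : ℝ} {a : Phase d → ℂ} (ha : a ∈ shubinClass d m)
    (α : MultiIndex d) : multiDeriv α a ∈ shubinClass d (m - (α.length : ℝ)) := by
  rw [multiDeriv_eq_wordDeriv, ← length_multiWord]
  exact wordDeriv_mem_shubinClass ha _

theorem const_smul_mem_shubinClass {m : ℝ} {a : Phase d → ℂ} (ha : a ∈ shubinClass d m) (c : ℂ) :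
    c • a ∈ shubinClass d m := by
  rw [shubinClass_iff_wordDeriv] at ha ⊢
  refine ⟨contDiff_complex_smul ha.1 c, fun w => ?_⟩
  obtain ⟨C, hC, h⟩ := ha.2 w
  refine ⟨(1 + ‖c‖) * C, by positivity, fun z => ?_⟩
  rw [wordDeriv_const_smul ha.1, Pi.smul_apply, norm_smul, mul_assoc]
  gcongr
  · simp
  · exact h z

theorem exists_norm_iteratedFDeriv_le {m : ℝ} {a : Phase d → ℂ} (ha : a ∈ shubinClass d m)
    (k : ℕ) : ∃ C : ℝ, 0 ≤ C ∧
      ∀ z, ‖iteratedFDeriv ℝ k a z‖ ≤ C * japanese z ^ (m - (k : ℝ)) := by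
  choose C hC h using (shubinClass_iff_wordDeriv.1 ha).2
  refine ⟨∑ r : Fin k → Fin d ⊕ Fin d, C (List.ofFn r), Finset.sum_nonneg fun r _ => (hC _).le,
    fun z => (norm_iteratedFDeriv_le_sum ha.1 k z).trans ?_⟩
  rw [Finset.sum_mul]
  refine Finset.sum_le_sum fun r _ => ?_
  simpa using h (List.ofFn r) z

theorem hasTemperateGrowth_of_mem_shubinClass {m : ℝ} {a : Phase d → ℂ}
    (ha : a ∈ shubinClass d m) : a.HasTemperateGrowth := by
  refine ⟨ha.1, fun k => ?_⟩
  obtain ⟨C, hC, h⟩ := exists_norm_iteratedFDeriv_le ha k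
  refine ⟨⌈|m - k|⌉₊, C, fun z => (h z).trans (mul_le_mul_of_nonneg_left ?_ hC)⟩
  calc japanese z ^ (m - (k : ℝ)) ≤ japanese z ^ (⌈|m - k|⌉₊ : ℝ) :=
        Real.rpow_le_rpow_of_exponent_le (one_le_japanese z)
          ((le_abs_self _).trans (Nat.le_ceil _))
    _ = japanese z ^ ⌈|m - k|⌉₊ := Real.rpow_natCast _ _
    _ ≤ _ := pow_le_pow_left₀ (japanese_pos z).le (japanese_le_one_add_norm z) _

theorem wordDeriv_gaussConv {m : ℝ} {a : Phase d → ℂ} (ha : a ∈ shubinClass d m)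
    (w : List (Fin d ⊕ Fin d)) : wordDeriv w (gaussConv a) = gaussConv (wordDeriv w a) := by
  induction w with
  | nil => rfl
  | cons i w ih =>
    rw [wordDeriv_cons, ih, partialDeriv_gaussConv
      (hasTemperateGrowth_of_mem_shubinClass (wordDeriv_mem_shubinClass ha w)), wordDeriv_cons]

/-! ### The asymptotic expansion -/

/-- Taylor's formula for symbols. The remainder has the decay of the `n`-th derivatives at the
centre `z`, because Peetre's inequality transports the bound along the segment from `z` to `z - w`
at the expense of a polynomial in `w`. -/
theorem exists_taylor_remainder_bound {m : ℝ} {a : Phase d → ℂ} (ha : a ∈ shubinClass d m)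
    (n : ℕ) : ∃ (C : ℝ) (K : ℕ), 0 ≤ C ∧ ∀ z w : Phase d,
      ‖a (z - w) - ∑ k ∈ Finset.range n,
        (k.factorial : ℝ)⁻¹ • iteratedFDeriv ℝ k a z (fun _ => -w)‖ ≤
      C * (1 + ‖w‖) ^ K * japanese z ^ (m - (n : ℝ)) := by
  obtain ⟨D, hD, h⟩ := exists_norm_iteratedFDeriv_le ha n
  obtain ⟨K, hK⟩ := exists_peetre d (m - n)
  cases n with
  | zero =>
    refine ⟨D * 2 ^ K, K, by positivity, fun z w => ?_⟩
    rw [Finset.range_zero, Finset.sum_empty, sub_zero]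
    calc ‖a (z - w)‖ ≤ D * japanese (z - w) ^ (m - ((0 : ℕ) : ℝ)) := by simpa using h (z - w)
      _ ≤ D * (2 ^ K * (1 + ‖w‖) ^ K * japanese z ^ (m - ((0 : ℕ) : ℝ))) := by
        gcongr; exact hK z w
      _ = _ := by ring
  | succ n =>
    refine ⟨(n.factorial : ℝ)⁻¹ * (D * 2 ^ K), K + (n + 1), by positivity, fun z w => ?_⟩
    have hz := japanese_pos z
    rw [sub_eq_add_neg z w, map_add_eq_sum_add_integral_iteratedFDeriv (n := n) (x := z) (y := -w)
      fun t _ => (contDiff_infty.1 ha.1 (n + 1)).contDiffAt, add_sub_cancel_left, norm_smul,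
      Real.norm_of_nonneg (by positivity), mul_assoc, mul_assoc]
    refine mul_le_mul_of_nonneg_left ?_ (by positivity)
    refine (intervalIntegral.norm_integral_le_of_norm_le_const (fun t ht => ?_)).trans
      (by rw [sub_zero, abs_one, mul_one])
    rw [Set.uIoc_of_le zero_le_one] at ht
    have h1 : ‖(1 - t) ^ n‖ ≤ 1 := by
      rw [norm_pow]
      exact pow_le_one₀ (norm_nonneg _)
        (by rw [Real.norm_eq_abs, abs_le]; constructor <;> linarith [ht.1, ht.2])
    have h2 : ‖t • w‖ ≤ ‖w‖ := by
      rw [norm_smul, Real.norm_of_nonneg ht.1.le]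
      exact mul_le_of_le_one_left (norm_nonneg w) ht.2
    have h3 : z + t • -w = z - t • w := by rw [smul_neg, ← sub_eq_add_neg]
    rw [norm_smul, h3]
    calc _ ≤ 1 * (‖iteratedFDeriv ℝ (n + 1) a (z - t • w)‖ * ∏ _j : Fin (n + 1), ‖-w‖) :=
          mul_le_mul h1 (ContinuousMultilinearMap.le_opNorm _ _) (norm_nonneg _) zero_le_one
      _ ≤ 1 * (D * (2 ^ K * (1 + ‖w‖) ^ K * japanese z ^ (m - ((n + 1 : ℕ) : ℝ))) *
          (1 + ‖w‖) ^ (n + 1)) := by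
        rw [Finset.prod_const, Finset.card_univ, Fintype.card_fin, norm_neg]
        gcongr
        · refine (h _).trans (mul_le_mul_of_nonneg_left ((hK z (t • w)).trans ?_) hD)
          gcongr
        · simp
      _ = _ := by rw [pow_add]; ring

/-- The moment `π^(-d) ∫ exp (-|w|²) ∏ⱼ (-w_{r j}) dw` of the Gaussian. -/
noncomputable def gaussMoment {k : ℕ} (r : Fin k → Fin d ⊕ Fin d) : ℂ :=
  ∫ w : Phase d, phaseGaussian d w * ((∏ j, phaseCoord (-w) (r j) : ℝ) : ℂ)

/-- The coefficients of the expansion of `π^(-d) exp (-|·|²) * a`. The Taylor formula is indexed by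
words, so that `c_α` collects the moments of all words with letter count `α`; no closed formula in
`α` is needed. -/
noncomputable def gaussCoeff (α : MultiIndex d) : ℂ :=
  (α.length.factorial : ℂ)⁻¹ * ∑ r : Fin α.length → Fin d ⊕ Fin d with
    wordCount (List.ofFn r) = α, gaussMoment r

theorem gaussCoeff_eq {α : MultiIndex d} {k : ℕ} (h : α.length = k) :
    gaussCoeff α = (k.factorial : ℂ)⁻¹ * ∑ r : Fin k → Fin d ⊕ Fin d with
      wordCount (List.ofFn r) = α, gaussMoment r := by
  subst h
  rfl

theorem integrable_gaussMoment {k : ℕ} (r : Fin k → Fin d ⊕ Fin d) :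
    Integrable fun w : Phase d => phaseGaussian d w * ((∏ j, phaseCoord (-w) (r j) : ℝ) : ℂ) := by
  refine (integrable_one_add_norm_pow_mul (phaseGaussian d) k).mono' ?_ (ae_of_all _ fun w => ?_)
  · refine ((phaseGaussian d).continuous.mul (Complex.continuous_ofReal.comp
      (continuous_finsetProd _ fun j _ => ?_))).aestronglyMeasurable
    exact (continuous_phaseCoord (r j)).comp continuous_neg
  · rw [norm_mul, mul_comm, Complex.norm_real, norm_prod]
    gcongr
    calc ∏ j, ‖phaseCoord (-w) (r j)‖ ≤ ∏ _j : Fin k, (1 + ‖w‖) := by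
          gcongr with j
          have := abs_phaseCoord_le (-w) (r j)
          rw [norm_neg] at this
          rw [Real.norm_eq_abs]
          linarith
      _ = _ := by simp

theorem length_eq_of_mem_piAntidiag {α : MultiIndex d} {k : ℕ}
    (h : α ∈ Finset.univ.piAntidiag k) : α.length = k :=
  (Finset.mem_piAntidiag.1 h).1

theorem phaseGaussian_mul_iteratedFDeriv {a : Phase d → ℂ} (ha : ContDiff ℝ ∞ a) (k : ℕ)
    (z w : Phase d) :
    phaseGaussian d w * ((k.factorial : ℝ)⁻¹ • iteratedFDeriv ℝ k a z (fun _ => -w)) =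
      ∑ r : Fin k → Fin d ⊕ Fin d, (phaseGaussian d w * ((∏ j, phaseCoord (-w) (r j) : ℝ) : ℂ)) *
        ((k.factorial : ℂ)⁻¹ * wordDeriv (List.ofFn r) a z) := by
  rw [iteratedFDeriv_apply_eq_sum ha, Finset.smul_sum, Finset.mul_sum]
  refine Finset.sum_congr rfl fun r _ => ?_
  rw [Complex.real_smul, Complex.real_smul]
  push_cast
  ring

theorem integrable_taylor_term {a : Phase d → ℂ} (ha : ContDiff ℝ ∞ a) (k : ℕ) (z : Phase d) :
    Integrable fun w => phaseGaussian d w *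
      ((k.factorial : ℝ)⁻¹ • iteratedFDeriv ℝ k a z (fun _ => -w)) := by
  simp_rw [phaseGaussian_mul_iteratedFDeriv ha]
  exact integrable_finsetSum _ fun r _ => (integrable_gaussMoment r).mul_const _

theorem integral_taylor_term {a : Phase d → ℂ} (ha : ContDiff ℝ ∞ a) (k : ℕ) (z : Phase d) :
    ∫ w, phaseGaussian d w * ((k.factorial : ℝ)⁻¹ • iteratedFDeriv ℝ k a z (fun _ => -w)) =
      ∑ α ∈ Finset.univ.piAntidiag k, gaussCoeff α * multiDeriv α a z := by
  simp_rw [phaseGaussian_mul_iteratedFDeriv ha]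
  rw [integral_finsetSum _ fun r _ => (integrable_gaussMoment r).mul_const _]
  have hmaps : ∀ r ∈ (Finset.univ : Finset (Fin k → Fin d ⊕ Fin d)),
      wordCount (List.ofFn r) ∈ (Finset.univ.piAntidiag k : Finset (MultiIndex d)) := by
    intro r _
    rw [Finset.mem_piAntidiag]
    exact ⟨(length_wordCount (List.ofFn r)).trans (List.length_ofFn), by simp⟩
  rw [← Finset.sum_fiberwise_of_maps_to hmaps]
  refine Finset.sum_congr rfl fun α hα => ?_
  rw [gaussCoeff_eq (length_eq_of_mem_piAntidiag hα), Finset.mul_sum, Finset.sum_mul]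
  refine Finset.sum_congr rfl fun r hr => ?_
  rw [integral_mul_const, wordDeriv_eq_multiDeriv ha, (Finset.mem_filter.1 hr).2, gaussMoment]
  ring

theorem integral_phaseGaussian (d : ℕ) : ∫ w, phaseGaussian d w = 1 := by
  simp_rw [phaseGaussian_apply]
  have h := GaussianFourier.integral_rexp_neg_mul_sq_norm (V := Phase d) one_pos
  have hd : (Module.finrank ℝ (Phase d) : ℝ) / 2 = d := by
    have : Module.finrank ℝ (Phase d) = d + d := by
      rw [(WithLp.linearEquiv 2 ℝ (Config d × Config d)).finrank_eq, Module.finrank_prod,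
        finrank_euclideanSpace_fin]
    rw [this]; push_cast; ring
  simp only [neg_one_mul, div_one, hd, Real.rpow_natCast] at h
  rw [integral_const_mul, integral_complex_ofReal, h]
  have : (Real.pi : ℂ) ≠ 0 := by exact_mod_cast Real.pi_ne_zero
  push_cast
  exact inv_mul_cancel₀ (pow_ne_zero d this)

theorem gaussCoeff_zero (d : ℕ) : gaussCoeff (0 : MultiIndex d) = 1 := by
  have h : MultiIndex.length (0 : MultiIndex d) = 0 := by simp [MultiIndex.length]
  have h0 : wordCount (d := d) [] = 0 := rfl
  simp [gaussCoeff_eq h, h0, gaussMoment, integral_phaseGaussian]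

/-- The remainder of the expansion in the supremum norm. Applied to the derivatives of a symbol,
which are again symbols, it gives all the estimates for the remainder. -/
theorem exists_norm_gaussConv_sub_le {m : ℝ} {a : Phase d → ℂ} (ha : a ∈ shubinClass d m)
    (n : ℕ) : ∃ C : ℝ, 0 < C ∧ ∀ z,
      ‖gaussConv a z - ∑ k ∈ Finset.range n, ∑ α ∈ Finset.univ.piAntidiag k,
        gaussCoeff α * multiDeriv α a z‖ ≤ C * japanese z ^ (m - (n : ℝ)) := by
  obtain ⟨C, K, hC, h⟩ := exists_taylor_remainder_bound ha n
  have hI := integrable_one_add_norm_pow_mul (phaseGaussian d) K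
  have hI0 : 0 ≤ ∫ w : Phase d, (1 + ‖w‖) ^ K * ‖phaseGaussian d w‖ :=
    integral_nonneg fun w => by positivity
  -- the summand `1` only serves to make the constant positive
  refine ⟨1 + C * ∫ w : Phase d, (1 + ‖w‖) ^ K * ‖phaseGaussian d w‖, by positivity, fun z => ?_⟩
  have hz : 0 ≤ japanese z ^ (m - (n : ℝ)) := Real.rpow_nonneg (japanese_pos z).le _
  simp_rw [← integral_taylor_term ha.1]
  have ha' := hasTemperateGrowth_of_mem_shubinClass ha
  have hint : Integrable fun w => phaseGaussian d w * a (z - w) :=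
    integrable_smul_sub (phaseGaussian d) ha' z
  rw [← integral_finsetSum _ fun k _ => integrable_taylor_term ha.1 k z, gaussConv,
    ← integral_sub hint
    (integrable_finsetSum _ fun k _ => integrable_taylor_term ha.1 k z)]
  calc _ ≤ ∫ w : Phase d, (C * japanese z ^ (m - (n : ℝ))) *
        ((1 + ‖w‖) ^ K * ‖phaseGaussian d w‖) := by
        refine norm_integral_le_of_norm_le (hI.const_mul _) (ae_of_all _ fun w => ?_)
        rw [← Finset.mul_sum, ← mul_sub, norm_mul]
        calc _ ≤ ‖phaseGaussian d w‖ * (C * (1 + ‖w‖) ^ K * japanese z ^ (m - (n : ℝ))) := by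
              gcongr; exact h z w
          _ = _ := by ring
    _ = C * (∫ w : Phase d, (1 + ‖w‖) ^ K * ‖phaseGaussian d w‖) * japanese z ^ (m - (n : ℝ)) := by
        rw [integral_const_mul]; ring
    _ ≤ _ := by gcongr; linarith

theorem gaussConv_sub_mem_shubinClass {m : ℝ} {a : Phase d → ℂ} (ha : a ∈ shubinClass d m)
    (n : ℕ) : gaussConv a - ∑ k ∈ Finset.range n, ∑ α ∈ Finset.univ.piAntidiag k,
      gaussCoeff α • multiDeriv α a ∈ shubinClass d (m - (n : ℝ)) := by
  have hb := contDiff_gaussConv (hasTemperateGrowth_of_mem_shubinClass ha)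
  have hα : ∀ α : MultiIndex d, ContDiff ℝ ∞ (gaussCoeff α • multiDeriv α a) := fun α =>
    (const_smul_mem_shubinClass (multiDeriv_mem_shubinClass ha α) _).1
  have hk : ∀ k : ℕ, ContDiff ℝ ∞ (∑ α ∈ Finset.univ.piAntidiag k,
      gaussCoeff α • multiDeriv α a) := fun k => contDiff_finset_sum _ fun α _ => hα α
  have hs := contDiff_finset_sum (Finset.range n) fun k _ => hk k
  refine shubinClass_iff_wordDeriv.2 ⟨hb.sub hs, fun w => ?_⟩
  obtain ⟨C, hC, h⟩ := exists_norm_gaussConv_sub_le (wordDeriv_mem_shubinClass ha w) n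
  refine ⟨C, hC, fun z => ?_⟩
  rw [sub_right_comm, wordDeriv_sub hb hs, wordDeriv_gaussConv ha,
    wordDeriv_sum _ fun k _ => hk k]
  convert h z using 2
  rw [Pi.sub_apply, Finset.sum_apply]
  refine congrArg _ (Finset.sum_congr rfl fun k _ => ?_)
  rw [wordDeriv_sum _ fun α _ => hα α, Finset.sum_apply]
  refine Finset.sum_congr rfl fun α _ => ?_
  rw [multiDeriv_eq_wordDeriv, wordDeriv_const_smul (contDiff_wordDeriv ha.1 _),
    wordDeriv_comm ha.1, ← multiDeriv_eq_wordDeriv]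
  rfl

/-! ### Characteristic set and microsupport -/

theorem multiDeriv_zero (a : Phase d → ℂ) : multiDeriv 0 a = a := by
  simp [multiDeriv]

/-- At points where `a` satisfies the hypoellipticity estimates, `gaussConv a` and `a` agree,
with all their derivatives, up to an error which is smaller by the factor `⟨z⟩⁻¹`. The order of the
expansion is chosen so large that its remainder is dominated by the lower bound
`C ⟨z⟩^m'` of `|a|`. -/
theorem exists_norm_gaussConv_sub_self_le {m m' : ℝ} {a : Phase d → ℂ} (ha : a ∈ shubinClass d m)
    {S : Set (Phase d)} {C : ℝ} (hC : 0 < C) {K : MultiIndex d → ℝ} (hK : ∀ α, 0 < K α)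
    (h : ∀ z ∈ S, C * japanese z ^ m' ≤ ‖a z‖ ∧
      ∀ α, ‖multiDeriv α a z‖ ≤ K α * ‖a z‖ * japanese z ^ (-(α.length : ℝ)))
    (w : List (Fin d ⊕ Fin d)) :
    ∃ L : ℝ, 0 < L ∧ ∀ z ∈ S, ‖wordDeriv w (gaussConv a) z - wordDeriv w a z‖ ≤
      L * ‖a z‖ * japanese z ^ (-(w.length : ℝ) - 1) := by
  obtain ⟨N, hN⟩ := exists_nat_ge (m - m')
  obtain ⟨D, hD, hb⟩ := exists_norm_gaussConv_sub_le (wordDeriv_mem_shubinClass ha w) (N + 1)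
  set M : MultiIndex d → ℝ := fun α =>
    ‖gaussCoeff α‖ * K (wordCount (multiWord α ++ w)) with hM
  have hM0 : ∀ α, 0 ≤ M α := fun α => mul_nonneg (norm_nonneg _) (hK _).le
  refine ⟨D / C + ∑ k ∈ Finset.range N, ∑ α ∈ Finset.univ.piAntidiag (k + 1), M α,
    add_pos_of_pos_of_nonneg (div_pos hD hC)
      (Finset.sum_nonneg fun k _ => Finset.sum_nonneg fun α _ => hM0 α), fun z hz => ?_⟩
  obtain ⟨hlow, hup⟩ := h z hz
  have hj := japanese_pos z
  have hj1 := one_le_japanese z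
  have h1 := hb z
  rw [Finset.sum_range_succ', Finset.piAntidiag_zero, Finset.sum_singleton, gaussCoeff_zero,
    one_mul, multiDeriv_zero, ← wordDeriv_gaussConv ha] at h1
  have hrem : D * japanese z ^ (m - (w.length : ℝ) - ((N + 1 : ℕ) : ℝ)) ≤
      D / C * (‖a z‖ * japanese z ^ (-(w.length : ℝ) - 1)) := by
    calc D * japanese z ^ (m - (w.length : ℝ) - ((N + 1 : ℕ) : ℝ)) ≤
          D * japanese z ^ (m' + (-(w.length : ℝ) - 1)) := by
          refine mul_le_mul_of_nonneg_left (Real.rpow_le_rpow_of_exponent_le hj1 ?_) hD.le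
          push_cast; linarith
      _ = D / C * ((C * japanese z ^ m') * japanese z ^ (-(w.length : ℝ) - 1)) := by
          rw [Real.rpow_add hj]; field_simp
      _ ≤ _ := by gcongr
  have hterm : ∀ k, ∀ α ∈ (Finset.univ.piAntidiag (k + 1) : Finset (MultiIndex d)),
      ‖gaussCoeff α * multiDeriv α (wordDeriv w a) z‖ ≤
        M α * (‖a z‖ * japanese z ^ (-(w.length : ℝ) - 1)) := by
    intro k α hα
    have hlen : ((wordCount (multiWord α ++ w)).length : ℝ) = (k + 1) + w.length := by
      rw [length_wordCount, List.length_append, length_multiWord, length_eq_of_mem_piAntidiag hα]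
      push_cast; ring
    rw [norm_mul, multiDeriv_eq_wordDeriv, ← wordDeriv_append, wordDeriv_eq_multiDeriv ha.1, hM,
      mul_assoc]
    refine mul_le_mul_of_nonneg_left ((hup _).trans ?_) (norm_nonneg _)
    rw [mul_assoc]
    refine mul_le_mul_of_nonneg_left (mul_le_mul_of_nonneg_left
      (Real.rpow_le_rpow_of_exponent_le hj1 ?_) (norm_nonneg _)) (hK _).le
    rw [hlen]
    linarith [(Nat.cast_nonneg k : (0 : ℝ) ≤ k)]
  have hsum : ‖∑ k ∈ Finset.range N, ∑ α ∈ Finset.univ.piAntidiag (k + 1),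
      gaussCoeff α * multiDeriv α (wordDeriv w a) z‖ ≤
      (∑ k ∈ Finset.range N, ∑ α ∈ Finset.univ.piAntidiag (k + 1), M α) *
        (‖a z‖ * japanese z ^ (-(w.length : ℝ) - 1)) := by
    rw [Finset.sum_mul]
    refine norm_sum_le_of_le _ fun k _ => ?_
    rw [Finset.sum_mul]
    exact norm_sum_le_of_le _ (hterm k)
  rw [mul_assoc, add_mul]
  calc _ = ‖(wordDeriv w (gaussConv a) z - (∑ k ∈ Finset.range N,
        ∑ α ∈ Finset.univ.piAntidiag (k + 1), gaussCoeff α * multiDeriv α (wordDeriv w a) z +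
          wordDeriv w a z)) + ∑ k ∈ Finset.range N, ∑ α ∈ Finset.univ.piAntidiag (k + 1),
            gaussCoeff α * multiDeriv α (wordDeriv w a) z‖ := by congr 1; ring
    _ ≤ _ := (norm_add_le _ _).trans (add_le_add (h1.trans hrem) hsum)

theorem nonHyperchar_gaussConv {m m' : ℝ} {a : Phase d → ℂ} (ha : a ∈ shubinClass d m)
    {z₀ : Phase d} (h : NonHyperchar m' a z₀) : NonHyperchar m' (gaussConv a) z₀ := by
  obtain ⟨Γ, hΓ, hz₀, A, C, K, hA, hC, hK, h⟩ := h
  choose L hL hLb using exists_norm_gaussConv_sub_self_le ha hC hK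
    (S := {z | z ∈ Γ ∧ A ≤ ‖z‖}) fun z hz => h z hz.1 hz.2
  refine ⟨Γ, hΓ, hz₀, max A (2 * L []), C / 2, fun α => 2 * (K α + L (multiWord α)),
    lt_max_of_lt_left hA, half_pos hC, fun α => by linarith [hK α, hL (multiWord α)],
    fun z hz hzA => ?_⟩
  have hzA' : A ≤ ‖z‖ := (le_max_left _ _).trans hzA
  obtain ⟨hlow, hup⟩ := h z hz hzA'
  have hj := japanese_pos z
  -- the error is at most half of `|a z|` as soon as `⟨z⟩ ≥ 2 L`
  have hhalf : ‖gaussConv a z - a z‖ ≤ ‖a z‖ / 2 := by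
    refine (hLb [] z ⟨hz, hzA'⟩).trans ?_
    have : L [] * japanese z ^ (-(([] : List (Fin d ⊕ Fin d)).length : ℝ) - 1) ≤ 1 / 2 := by
      rw [List.length_nil, Nat.cast_zero, neg_zero, zero_sub, Real.rpow_neg_one,
        ← div_eq_mul_inv, div_le_iff₀ hj]
      linarith [le_max_right A (2 * L []), norm_le_japanese z]
    nlinarith [norm_nonneg (a z)]
  have hab : ‖a z‖ ≤ 2 * ‖gaussConv a z‖ := by
    have := norm_sub_norm_le (a z) (gaussConv a z)
    rw [norm_sub_rev] at this
    linarith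
  refine ⟨by linarith, fun α => ?_⟩
  have hle : japanese z ^ (-(α.length : ℝ) - 1) ≤ japanese z ^ (-(α.length : ℝ)) :=
    Real.rpow_le_rpow_of_exponent_le (one_le_japanese z) (by linarith)
  have h1 := hLb (multiWord α) z ⟨hz, hzA'⟩
  rw [← multiDeriv_eq_wordDeriv, ← multiDeriv_eq_wordDeriv, length_multiWord] at h1
  have hLα := (hL (multiWord α)).le
  calc ‖multiDeriv α (gaussConv a) z‖ =
        ‖multiDeriv α a z + (multiDeriv α (gaussConv a) z - multiDeriv α a z)‖ := by
        rw [add_sub_cancel]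
    _ ≤ K α * ‖a z‖ * japanese z ^ (-(α.length : ℝ)) +
        L (multiWord α) * ‖a z‖ * japanese z ^ (-(α.length : ℝ)) :=
        (norm_add_le _ _).trans (add_le_add (hup α) (h1.trans (by gcongr)))
    _ = (K α + L (multiWord α)) * ‖a z‖ * japanese z ^ (-(α.length : ℝ)) := by ring
    _ ≤ (K α + L (multiWord α)) * (2 * ‖gaussConv a z‖) * japanese z ^ (-(α.length : ℝ)) := by
        have := (hK α).le
        gcongr
    _ = _ := by ring

theorem hypercharSet_gaussConv_subset {m : ℝ} {a : Phase d → ℂ} (ha : a ∈ shubinClass d m)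
    (m' : ℝ) : hypercharSet m' (gaussConv a) ⊆ hypercharSet m' a :=
  fun _ hz => ⟨hz.1, fun h => hz.2 (nonHyperchar_gaussConv ha h)⟩

/-- Rapid decrease of all derivatives on a set passes from `a` to `gaussConv a`: given the rate
`N`, expand to an order at which the remainder decreases at this rate everywhere. -/
theorem rapidDecrease_gaussConv {m : ℝ} {a : Phase d → ℂ} (ha : a ∈ shubinClass d m)
    {S : Set (Phase d)} (h : ∀ (α : MultiIndex d) (N : ℝ), 0 ≤ N →
      ∃ C : ℝ, ∀ z ∈ S, japanese z ^ N * ‖multiDeriv α a z‖ ≤ C)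
    (β : MultiIndex d) {N : ℝ} (hN : 0 ≤ N) :
    ∃ C : ℝ, ∀ z ∈ S, japanese z ^ N * ‖multiDeriv β (gaussConv a) z‖ ≤ C := by
  set w := multiWord β
  obtain ⟨n, hn⟩ := exists_nat_ge (N + (m - w.length))
  obtain ⟨D, hD, hb⟩ := exists_norm_gaussConv_sub_le (wordDeriv_mem_shubinClass ha w) n
  choose B hB using fun α => h (wordCount (multiWord α ++ w)) N hN
  refine ⟨D + ∑ k ∈ Finset.range n, ∑ α ∈ Finset.univ.piAntidiag k, ‖gaussCoeff α‖ * B α,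
    fun z hz => ?_⟩
  have hj := japanese_pos z
  have hrem : japanese z ^ N * (D * japanese z ^ (m - (w.length : ℝ) - (n : ℝ))) ≤ D := by
    rw [mul_left_comm, ← Real.rpow_add hj]
    exact mul_le_of_le_one_right hD.le
      (Real.rpow_le_one_of_one_le_of_nonpos (one_le_japanese z) (by linarith))
  have hsum : japanese z ^ N * ‖∑ k ∈ Finset.range n, ∑ α ∈ Finset.univ.piAntidiag k,
      gaussCoeff α * multiDeriv α (wordDeriv w a) z‖ ≤
      ∑ k ∈ Finset.range n, ∑ α ∈ Finset.univ.piAntidiag k, ‖gaussCoeff α‖ * B α := by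
    have hjN := Real.rpow_nonneg hj.le N
    rw [← abs_of_nonneg hjN, ← Real.norm_eq_abs, ← norm_smul, Finset.smul_sum]
    refine norm_sum_le_of_le _ fun k _ => ?_
    rw [Finset.smul_sum]
    refine norm_sum_le_of_le _ fun α _ => ?_
    rw [norm_smul, norm_mul, Real.norm_of_nonneg hjN, mul_left_comm, multiDeriv_eq_wordDeriv,
      ← wordDeriv_append, wordDeriv_eq_multiDeriv ha.1]
    exact mul_le_mul_of_nonneg_left (hB α z hz) (norm_nonneg _)
  rw [multiDeriv_eq_wordDeriv, wordDeriv_gaussConv ha]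
  have h1 := mul_le_mul_of_nonneg_left ((norm_le_norm_add_norm_sub' _ _).trans
    (add_le_add_right (hb z) _)) (Real.rpow_nonneg hj.le N)
  rw [mul_add] at h1
  exact h1.trans ((add_le_add hsum hrem).trans_eq (add_comm _ _))

theorem microSupport_gaussConv_subset {m : ℝ} {a : Phase d → ℂ} (ha : a ∈ shubinClass d m) :
    microSupport (gaussConv a) ⊆ microSupport a := by
  rintro z ⟨hz, hb⟩
  refine ⟨hz, fun ⟨Γ, hΓ, hzΓ, h⟩ => hb ⟨Γ, hΓ, hzΓ, fun β N hN => ?_⟩⟩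
  exact rapidDecrease_gaussConv ha h β hN

/-! ### Convolution of distributions and of functions -/

theorem phaseGaussian_neg (w : Phase d) : phaseGaussian d (-w) = phaseGaussian d w := by
  rw [phaseGaussian_apply, phaseGaussian_apply, norm_neg]

/-- The involution `(z, w) ↦ (z - w, -w)` of pairs of phase space points. -/
def shearReflect (d : ℕ) : Phase d × Phase d ≃ᵐ Phase d × Phase d where
  toFun p := (p.1 - p.2, -p.2)
  invFun p := (p.1 - p.2, -p.2)
  left_inv p := by simp
  right_inv p := by simp
  measurable_toFun := by
    change Measurable fun p : Phase d × Phase d => (p.1 - p.2, -p.2)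
    fun_prop
  measurable_invFun := by
    change Measurable fun p : Phase d × Phase d => (p.1 - p.2, -p.2)
    fun_prop

theorem measurePreserving_shearReflect (d : ℕ) :
    MeasurePreserving (shearReflect d) (volume.prod volume) (volume.prod volume) :=
  ((MeasurePreserving.id volume).prod
    (LinearIsometryEquiv.neg ℝ (E := Phase d)).measurePreserving).comp
    (measurePreserving_sub_prod volume volume)

/-- The transpose of the convolution with the Gaussian is again this convolution, because the
Gaussian is even: the double integrals are exchanged by `shearReflect`. -/
theorem integral_gaussConv_mul {a : Phase d → ℂ} (ha : a.HasTemperateGrowth) (φ : 𝓢(Phase d, ℂ)) :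
    ∫ z, gaussConv φ z * a z = ∫ z, φ z * gaussConv a z := by
  set G : Phase d × Phase d → ℂ := fun p => phaseGaussian d p.2 * a (p.1 - p.2) * φ p.1 with hG
  have hint : Integrable G (volume.prod volume) := by
    obtain ⟨k, C, hC, h⟩ := ha.norm_iteratedFDeriv_le_uniform 0
    have hc : Continuous a := ha.1.continuous
    have hcG : Continuous G := by
      have := (phaseGaussian d).continuous
      have := φ.continuous
      fun_prop
    refine (((integrable_one_add_norm_pow_mul φ k).mul_prod
      (integrable_one_add_norm_pow_mul (phaseGaussian d) k)).const_mul C).mono'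
      hcG.aestronglyMeasurable (ae_of_all _ fun p => ?_)
    have h1 := norm_smul_sub_le (phaseGaussian d) hC (fun z => by simpa using h 0 le_rfl z)
      (le_refl ‖p.1‖) p.2
    rw [smul_eq_mul] at h1
    calc ‖G p‖ = ‖phaseGaussian d p.2 * a (p.1 - p.2)‖ * ‖φ p.1‖ := norm_mul _ _
      _ ≤ C * (1 + ‖p.1‖) ^ k * ((1 + ‖p.2‖) ^ k * ‖phaseGaussian d p.2‖) * ‖φ p.1‖ := by gcongr
      _ = _ := by ring
  have hcomp : ∀ p, G (shearReflect d p) = phaseGaussian d p.2 * φ (p.1 - p.2) * a p.1 := by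
    intro p
    change phaseGaussian d (-p.2) * a (p.1 - p.2 - -p.2) * φ (p.1 - p.2) = _
    rw [phaseGaussian_neg, sub_neg_eq_add, sub_add_cancel]
    ring
  have hint' : Integrable (fun p => G (shearReflect d p)) (volume.prod volume) :=
    (measurePreserving_shearReflect d).integrable_comp_of_integrable hint
  have h1 : ∫ z, φ z * gaussConv a z = ∫ p, G p ∂(volume.prod volume) := by
    rw [integral_prod _ hint]
    refine integral_congr_ae (ae_of_all _ fun z => ?_)
    simp only [hG, gaussConv]
    rw [integral_mul_const, mul_comm]
  rw [h1, ← (measurePreserving_shearReflect d).integral_comp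
    (shearReflect d).measurableEmbedding, integral_prod _ hint']
  refine integral_congr_ae (ae_of_all _ fun z => ?_)
  simp only [hcomp, gaussConv]
  rw [integral_mul_const]

theorem gaussConvDist_toTemperedDistribution {a : Phase d → ℂ} (ha : a.HasTemperateGrowth)
    (hb : (gaussConv a).HasTemperateGrowth) :
    gaussConvDist (ha.toTemperedDistribution volume) = hb.toTemperedDistribution volume := by
  ext φ
  change ∫ z, convolution (ContinuousLinearMap.mul ℂ ℂ) (phaseGaussian d) φ z • a z =
    ∫ z, φ z • gaussConv a z
  simp_rw [convolution_phaseGaussian_apply, smul_eq_mul]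
  exact integral_gaussConv_mul ha φ

/-! ### Localization operators as Weyl operators -/

theorem exists_norm_le_schwartz {V : Type*} [NormedAddCommGroup V] [NormedSpace ℝ V]
    (f : 𝓢(V, ℂ)) : ∃ C : ℝ, 0 ≤ C ∧ ∀ x, ‖f x‖ ≤ C := by
  obtain ⟨C, hC, h⟩ := f.decay 0 0
  exact ⟨C, hC.le, fun x => by simpa using h x⟩

theorem integrable_exp_neg_mul_sq_norm {b : ℝ} (hb : 0 < b) :
    Integrable fun x : Config d => Real.exp (-b * ‖x‖ ^ 2) := by
  refine (gaussianSchwartz (Config d) hb).integrable.norm.congr (ae_of_all _ fun x => ?_)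
  simp only [gaussianSchwartz_apply, Complex.norm_real, Real.norm_eq_abs, Real.abs_exp]

/-- The product `V_{ψ₀} f · conj (V_{ψ₀} (conj φ))` at `z = (x, ξ)` is a double integral of
`f y φ y'`; this is its integrand in the variables `y` and `t = y' - y`. The two Gaussian windows
have been combined into one Gaussian in `t` and one in the midpoint of `y` and `y'`. -/
noncomputable def wickKernel (f φ : Config d → ℂ) (z : Phase d) (y t : Config d) : ℂ :=
  f y * φ (y + t) * (Complex.exp ((inner ℝ t z.snd : ℝ) * I) *
    (((Real.pi ^ (-(d : ℝ) / 4)) ^ 2 * Real.exp (-(1 / 4) * ‖t‖ ^ 2) *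
      Real.exp (-1 * ‖y - z.fst + (1 / 2 : ℝ) • t‖ ^ 2) : ℝ) : ℂ))

theorem norm_wickKernel (f φ : Config d → ℂ) (z : Phase d) (y t : Config d) :
    ‖wickKernel f φ z y t‖ = ‖f y‖ * ‖φ (y + t)‖ * ((Real.pi ^ (-(d : ℝ) / 4)) ^ 2 *
      Real.exp (-(1 / 4) * ‖t‖ ^ 2) * Real.exp (-1 * ‖y - z.fst + (1 / 2 : ℝ) • t‖ ^ 2)) := by
  rw [wickKernel, norm_mul, norm_mul, norm_mul, Complex.norm_exp_ofReal_mul_I, one_mul,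
    Complex.norm_real, Real.norm_of_nonneg (by positivity)]

theorem continuous_wickKernel (f φ : 𝓢(Config d, ℂ)) (z : Phase d) :
    Continuous fun p : Config d × Config d => wickKernel f φ z p.1 p.2 := by
  have := f.continuous
  have := φ.continuous
  unfold wickKernel
  fun_prop

theorem integrable_wickKernel (f φ : 𝓢(Config d, ℂ)) (z : Phase d) :
    Integrable (Function.uncurry (wickKernel f φ z)) (volume.prod volume) := by
  obtain ⟨C, hC, hφ⟩ := exists_norm_le_schwartz φ
  refine ((f.integrable.norm.mul_prod (integrable_exp_neg_mul_sq_norm (d := d)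
    (b := 1 / 4) (by norm_num))).const_mul (C * (Real.pi ^ (-(d : ℝ) / 4)) ^ 2)).mono'
    (continuous_wickKernel f φ z).aestronglyMeasurable (ae_of_all _ fun p => ?_)
  change ‖wickKernel f φ z p.1 p.2‖ ≤ _
  rw [norm_wickKernel]
  have h1 : Real.exp (-1 * ‖p.1 - z.fst + (1 / 2 : ℝ) • p.2‖ ^ 2) ≤ 1 :=
    Real.exp_le_one_iff.2 (by nlinarith [sq_nonneg ‖p.1 - z.fst + (1 / 2 : ℝ) • p.2‖])
  calc _ ≤ ‖f p.1‖ * C * ((Real.pi ^ (-(d : ℝ) / 4)) ^ 2 *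
        Real.exp (-(1 / 4) * ‖p.2‖ ^ 2) * 1) := by gcongr; exact hφ _
    _ = _ := by ring

theorem integrable_wickKernel_midpoint (f φ : 𝓢(Config d, ℂ)) (z : Phase d) :
    Integrable (Function.uncurry fun u t : Config d =>
      wickKernel f φ z (z.fst - (1 / 2 : ℝ) • t - u) t) (volume.prod volume) := by
  obtain ⟨B, hB, hf⟩ := exists_norm_le_schwartz f
  obtain ⟨C, hC, hφ⟩ := exists_norm_le_schwartz φ
  have hcont : Continuous fun p : Config d × Config d =>
      wickKernel f φ z (z.fst - (1 / 2 : ℝ) • p.2 - p.1) p.2 :=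
    (continuous_wickKernel f φ z).comp
      (g := fun p : Config d × Config d => wickKernel f φ z p.1 p.2)
      (f := fun p : Config d × Config d => (z.fst - (1 / 2 : ℝ) • p.2 - p.1, p.2)) (by fun_prop)
  refine (((integrable_exp_neg_mul_sq_norm (d := d) one_pos).mul_prod
    (integrable_exp_neg_mul_sq_norm (d := d) (b := 1 / 4) (by norm_num))).const_mul
    (B * C * (Real.pi ^ (-(d : ℝ) / 4)) ^ 2)).mono'
    hcont.aestronglyMeasurable (ae_of_all _ fun p => ?_)
  change ‖wickKernel f φ z (z.fst - (1 / 2 : ℝ) • p.2 - p.1) p.2‖ ≤ _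
  have e : z.fst - (1 / 2 : ℝ) • p.2 - p.1 - z.fst + (1 / 2 : ℝ) • p.2 = -p.1 := by abel
  rw [norm_wickKernel, e, norm_neg]
  calc _ ≤ B * C * ((Real.pi ^ (-(d : ℝ) / 4)) ^ 2 *
        Real.exp (-(1 / 4) * ‖p.2‖ ^ 2) * Real.exp (-1 * ‖p.1‖ ^ 2)) := by
        gcongr
        · exact hf _
        · exact hφ _
    _ = _ := by ring

/-- The parallelogram identity for the Gaussian windows. -/
theorem gaussianWindow_mul (v t : Config d) : gaussianWindow d v * gaussianWindow d (v + t) =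
    (((Real.pi ^ (-(d : ℝ) / 4)) ^ 2 * Real.exp (-(1 / 4) * ‖t‖ ^ 2) *
      Real.exp (-1 * ‖v + (1 / 2 : ℝ) • t‖ ^ 2) : ℝ) : ℂ) := by
  have h : -(1 / 2) * ‖v‖ ^ 2 + -(1 / 2) * ‖v + t‖ ^ 2 =
      -(1 / 4) * ‖t‖ ^ 2 + -1 * ‖v + (1 / 2 : ℝ) • t‖ ^ 2 := by
    rw [norm_add_sq_real, norm_add_sq_real, inner_smul_right, norm_smul]
    norm_num
    ring
  rw [gaussianWindow_apply, gaussianWindow_apply, ← Complex.ofReal_mul, Complex.ofReal_inj]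
  calc _ = (Real.pi ^ (-(d : ℝ) / 4)) ^ 2 *
        Real.exp (-(1 / 2) * ‖v‖ ^ 2 + -(1 / 2) * ‖v + t‖ ^ 2) := by rw [Real.exp_add]; ring
    _ = _ := by rw [h, Real.exp_add]; ring

theorem stftProduct_eq_integral (f φ : 𝓢(Config d, ℂ)) (z : Phase d) :
    stftProduct f φ z = ∫ y, ∫ t, wickKernel f φ z y t := by
  set T := timeFreqShift z (gaussianWindow d) with hT
  have h1 : stftProduct f φ z = (∫ y, f y * conj (T y)) * ∫ y, φ y * T y := by
    change stftCLM (gaussianWindow d) f z *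
      conj (stftCLM (gaussianWindow d) (conjCLM _ φ) z) = _
    rw [stftCLM_apply, stftCLM_apply, stft, stft, ← integral_conj]
    congr 2
    funext y
    rw [map_mul, conjCLM_apply, Complex.conj_conj, Complex.conj_conj]
  rw [h1, ← integral_mul_const]
  refine integral_congr_ae (ae_of_all _ fun y => ?_)
  dsimp only
  rw [← integral_add_left_eq_self (fun y' => φ y' * T y') y, ← integral_const_mul]
  refine integral_congr_ae (ae_of_all _ fun t => ?_)
  have hreal : conj (gaussianWindow d (y - z.fst)) = gaussianWindow d (y - z.fst) := by
    rw [gaussianWindow_apply, Complex.conj_ofReal]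
  have hexp : Complex.exp (conj (((inner ℝ y z.snd : ℝ) : ℂ) * I)) *
      Complex.exp (((inner ℝ (y + t) z.snd : ℝ) : ℂ) * I) =
      Complex.exp (((inner ℝ t z.snd : ℝ) : ℂ) * I) := by
    rw [← Complex.exp_add, map_mul, Complex.conj_ofReal, Complex.conj_I, inner_add_left]
    congr 1
    push_cast
    ring
  simp only [hT, timeFreqShift, wickKernel]
  rw [map_mul, hreal, ← gaussianWindow_mul, ← hexp, ← Complex.exp_conj,
    show y + t - z.fst = y - z.fst + t by abel]
  ring

/-- The Fourier transform of the frequency part of the Gaussian on phase space. The normalizations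
match: `π^(-d) π^(d/2)` is the square of the factor `π^(-d/4)` of the window. -/
theorem integral_gaussian_mul_exp (t : Config d) :
    ((Real.pi : ℂ) ^ d)⁻¹ * ∫ η : Config d, (Real.exp (-1 * ‖η‖ ^ 2) : ℂ) *
      Complex.exp (((-inner ℝ t η : ℝ) : ℂ) * I) =
      (((Real.pi ^ (-(d : ℝ) / 4)) ^ 2 * Real.exp (-(1 / 4) * ‖t‖ ^ 2) : ℝ) : ℂ) := by
  have h := GaussianFourier.integral_cexp_neg_mul_sq_norm_add (V := Config d) (b := 1)
    (by simp) (-I) t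
  have hpi : ((Real.pi : ℂ) ^ d)⁻¹ * ((Real.pi : ℂ) / 1) ^ ((d : ℂ) / 2) =
      (((Real.pi ^ (-(d : ℝ) / 4)) ^ 2 : ℝ) : ℂ) := by
    have e : ((Real.pi : ℂ) / 1) ^ ((d : ℂ) / 2) = ((Real.pi ^ ((d : ℝ) / 2) : ℝ) : ℂ) := by
      rw [Complex.ofReal_cpow Real.pi_pos.le, div_one]
      push_cast
      rfl
    rw [e, ← Complex.ofReal_pow, ← Complex.ofReal_inv, ← Complex.ofReal_mul, Complex.ofReal_inj,
      ← Real.rpow_natCast, ← Real.rpow_natCast, ← Real.rpow_neg Real.pi_pos.le,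
      ← Real.rpow_add Real.pi_pos, ← Real.rpow_mul Real.pi_pos.le]
    congr 1
    push_cast
    ring
  have hint : ∀ η : Config d, (Real.exp (-1 * ‖η‖ ^ 2) : ℂ) *
      Complex.exp (((-inner ℝ t η : ℝ) : ℂ) * I) =
      Complex.exp (-1 * (‖η‖ : ℂ) ^ 2 + -I * (inner ℝ t η : ℝ)) := by
    intro η
    rw [Complex.ofReal_exp, ← Complex.exp_add]
    congr 1
    push_cast
    ring
  simp_rw [hint]
  rw [h, finrank_euclideanSpace_fin, ← mul_assoc, hpi, Complex.ofReal_mul, Complex.ofReal_exp]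
  congr 2
  rw [neg_sq, Complex.I_sq]
  push_cast
  ring

/-- In the convolution with the Gaussian, the integral over the frequency shift `η` at a fixed
position shift `u` turns the integral over `t` in the Wigner transform into one of `wickKernel`,
taken at the `y` for which `y` and `y + t` have the midpoint `x - u`. -/
theorem integral_frequency_gaussConv (f φ : 𝓢(Config d, ℂ)) (z : Phase d) (u : Config d) :
    ∫ η, phaseGaussian d (WithLp.toLp 2 (u, η)) *
      wignerCLM f φ (z - WithLp.toLp 2 (u, η)) =
    ∫ t, wickKernel f φ z (z.fst - (1 / 2 : ℝ) • t - u) t := by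
  set F : Config d → ℂ := fun t =>
    f (z.fst - u - (1 / 2 : ℝ) • t) * φ (z.fst - u + (1 / 2 : ℝ) • t) with hF
  have hfc := f.continuous
  have hφc := φ.continuous
  have hFint : Integrable F := by
    obtain ⟨B, hB, hf⟩ := exists_norm_le_schwartz f
    have hφ : Integrable fun t : Config d => φ (z.fst - u + (1 / 2 : ℝ) • t) :=
      (φ.integrable.comp_add_left (z.fst - u)).comp_smul (by norm_num)
    exact hφ.bdd_mul (c := B) (by fun_prop) (ae_of_all _ fun t => hf _)
  have hg : ∀ η : Config d, phaseGaussian d (WithLp.toLp 2 (u, η)) =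
      ((Real.pi : ℂ) ^ d)⁻¹ * (Real.exp (-1 * ‖u‖ ^ 2) : ℂ) * (Real.exp (-1 * ‖η‖ ^ 2) : ℂ) := by
    intro η
    rw [phaseGaussian_apply, WithLp.prod_norm_sq_eq_of_L2, mul_assoc, ← Complex.ofReal_mul,
      ← Real.exp_add]
    congr 4
    change -(‖u‖ ^ 2 + ‖η‖ ^ 2) = _
    ring
  have hW : ∀ η : Config d, phaseGaussian d (WithLp.toLp 2 (u, η)) *
      wignerCLM f φ (z - WithLp.toLp 2 (u, η)) =
      ∫ t, ((Real.pi : ℂ) ^ d)⁻¹ * (Real.exp (-1 * ‖u‖ ^ 2) : ℂ) *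
        ((Real.exp (-1 * ‖η‖ ^ 2) : ℂ) *
          (Complex.exp ((inner ℝ t (z.snd - η) : ℝ) * I) * F t)) := by
    intro η
    rw [hg, wignerCLM_apply, crossWigner, integral_const_mul, integral_const_mul, mul_assoc]
    rfl
  have hswap : Integrable (Function.uncurry fun η t : Config d =>
      ((Real.pi : ℂ) ^ d)⁻¹ * (Real.exp (-1 * ‖u‖ ^ 2) : ℂ) *
        ((Real.exp (-1 * ‖η‖ ^ 2) : ℂ) *
          (Complex.exp ((inner ℝ t (z.snd - η) : ℝ) * I) * F t))) (volume.prod volume) := by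
    refine Integrable.const_mul ?_ _
    refine ((integrable_exp_neg_mul_sq_norm (d := d) one_pos).mul_prod hFint.norm).mono' ?_
      (ae_of_all _ fun p => ?_)
    · have : Continuous fun p : Config d × Config d => (Real.exp (-1 * ‖p.1‖ ^ 2) : ℂ) *
          (Complex.exp ((inner ℝ p.2 (z.snd - p.1) : ℝ) * I) * F p.2) := by fun_prop
      exact this.aestronglyMeasurable
    · rw [norm_mul, norm_mul, Complex.norm_exp_ofReal_mul_I, one_mul, Complex.norm_real,
        Real.norm_eq_abs, Real.abs_exp]
  simp_rw [hW]
  rw [integral_integral_swap hswap]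
  refine integral_congr_ae (ae_of_all _ fun t => ?_)
  have e : ∀ η : Config d, ((Real.pi : ℂ) ^ d)⁻¹ * (Real.exp (-1 * ‖u‖ ^ 2) : ℂ) *
        ((Real.exp (-1 * ‖η‖ ^ 2) : ℂ) * (Complex.exp ((inner ℝ t (z.snd - η) : ℝ) * I) * F t)) =
      ((Real.exp (-1 * ‖u‖ ^ 2) : ℂ) * Complex.exp ((inner ℝ t z.snd : ℝ) * I) * F t *
        ((Real.pi : ℂ) ^ d)⁻¹) * ((Real.exp (-1 * ‖η‖ ^ 2) : ℂ) *
          Complex.exp (((-inner ℝ t η : ℝ) : ℂ) * I)) := by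
    intro η
    have : Complex.exp ((inner ℝ t (z.snd - η) : ℝ) * I) =
        Complex.exp ((inner ℝ t z.snd : ℝ) * I) *
          Complex.exp (((-inner ℝ t η : ℝ) : ℂ) * I) := by
      rw [← Complex.exp_add, inner_sub_right]
      congr 1
      push_cast
      ring
    rw [this]
    ring
  simp_rw [e]
  rw [integral_const_mul, mul_assoc _ (((Real.pi : ℂ) ^ d)⁻¹), integral_gaussian_mul_exp,
    wickKernel]
  have e1 : z.fst - (1 / 2 : ℝ) • t - u = z.fst - u - (1 / 2 : ℝ) • t := by abel
  have e2 : z.fst - u - (1 / 2 : ℝ) • t + t = z.fst - u + (1 / 2 : ℝ) • t := by module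
  have e3 : z.fst - u - (1 / 2 : ℝ) • t - z.fst + (1 / 2 : ℝ) • t = -u := by abel
  rw [e1, e2, e3, norm_neg, hF]
  push_cast
  ring

theorem gaussConv_wignerCLM_eq_integral (f φ : 𝓢(Config d, ℂ)) (z : Phase d) :
    gaussConv (wignerCLM f φ) z = ∫ t, ∫ y, wickKernel f φ z y t := by
  obtain ⟨C, hC, hW⟩ := exists_norm_le_schwartz (wignerCLM f φ)
  have hWc := (wignerCLM f φ).continuous
  have hint : Integrable fun w : Phase d => phaseGaussian d w * wignerCLM f φ (z - w) :=
    (phaseGaussian d).integrable.mul_bdd (c := C) (by fun_prop) (ae_of_all _ fun w => hW _)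
  have hint2 : Integrable (fun p : Config d × Config d => phaseGaussian d (WithLp.toLp 2 p) *
      wignerCLM f φ (z - WithLp.toLp 2 p)) :=
    (WithLp.volume_preserving_toLp (Config d) (Config d)).integrable_comp_of_integrable hint
  rw [Measure.volume_eq_prod] at hint2
  rw [gaussConv, integral_phase, Measure.volume_eq_prod, integral_prod _ hint2]
  simp_rw [integral_frequency_gaussConv]
  rw [integral_integral_swap (integrable_wickKernel_midpoint f φ z)]
  refine integral_congr_ae (ae_of_all _ fun t => ?_)
  exact integral_sub_left_eq_self (fun y => wickKernel f φ z y t) volume _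

/-- The localization operator with symbol `δ_z` has the Weyl symbol
`π^(-d) exp (-|· - z|²)`; in weak form, the product of the short-time Fourier transforms is the
Wigner transform smoothed by the Gaussian. -/
theorem stftProduct_eq_convolution (f φ : 𝓢(Config d, ℂ)) :
    stftProduct f φ =
      convolution (ContinuousLinearMap.mul ℂ ℂ) (phaseGaussian d) (wignerCLM f φ) := by
  ext z
  rw [convolution_phaseGaussian_apply, gaussConv_wignerCLM_eq_integral, stftProduct_eq_integral,
    integral_integral_swap (integrable_wickKernel f φ z)]

theorem localizationOp_eq_weylOp (a : 𝓢'(Phase d, ℂ)) :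
    localizationOp a = weylOp (gaussConvDist a) := by
  ext f φ
  change ((2 * Real.pi : ℂ) ^ d)⁻¹ * a (stftProduct f φ) =
    ((2 * Real.pi : ℂ) ^ d)⁻¹ * a (convolution (ContinuousLinearMap.mul ℂ ℂ)
      (phaseGaussian d) (wignerCLM f φ))
  rw [stftProduct_eq_convolution]

end

end WeylWick

theorem mainTheorem9 (d : ℕ) :
    (∀ a : 𝓢'(Phase d, ℂ), localizationOp a = weylOp (gaussConvDist a)) ∧
    ∃ c : MultiIndex d → ℂ, c 0 = 1 ∧
      ∀ (m : ℝ) (a : Phase d → ℂ), a ∈ shubinClass d m →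
        (∃ (ha : a.HasTemperateGrowth) (hb : (gaussConv a).HasTemperateGrowth),
          gaussConvDist (ha.toTemperedDistribution MeasureTheory.volume) =
            hb.toTemperedDistribution MeasureTheory.volume) ∧
        gaussConv a ∈ shubinClass d m ∧
        HasAsymptoticExpansion m (gaussConv a) (fun α => c α • multiDeriv α a) ∧
        (∀ m' : ℝ, m' ≤ m → hypercharSet m' (gaussConv a) ⊆ hypercharSet m' a) ∧
        microSupport (gaussConv a) ⊆ microSupport a := by
  refine ⟨localizationOp_eq_weylOp, gaussCoeff, gaussCoeff_zero d, fun m a ha => ?_⟩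
  have hb : gaussConv a ∈ shubinClass d m := by
    simpa using gaussConv_sub_mem_shubinClass ha 0
  have ha' := hasTemperateGrowth_of_mem_shubinClass ha
  have hb' := hasTemperateGrowth_of_mem_shubinClass hb
  exact ⟨⟨ha', hb', gaussConvDist_toTemperedDistribution ha' hb'⟩, hb,
    ⟨fun α => const_smul_mem_shubinClass (multiDeriv_mem_shubinClass ha α) _,
      fun n _ => gaussConv_sub_mem_shubinClass ha n⟩,
    fun m' _ => hypercharSet_gaussConv_subset ha m', microSupport_gaussConv_subset ha⟩
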